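/- A (turn-based) stochastic game $\mathcal{G}=(S_{\mathrm{Max}},S_{\mathrm{Min}},\mathsf{Act},P)$ consists of a finite non-empty state set $S=S_{\mathrm{Max}}\uplus S_{\mathrm{Min}}$, a finite set $L$ of action labels, a non-empty set $\mathsf{Act}(s)\subseteq L$ of available actions for each $s\in S$, and for each $s\in S$, $a\in\mathsf{Act}(s)$ a probability distribution $P(s,a,\cdot)$ on $S$. A state $s$ is a sink if $P(s,a,s)=1$ for all $a\in\mathsf{Act}(s)$. A strategy $\sigma$ of Max (resp. $\tau$ of Min) maps each history in $(S\times L)^*\times S_{\mathrm{Max}}$ (resp. $(S\times L)^*\times S_{\mathrm{Min}}$) to a probability distribution on the actions available in its last state; $\mathbb{P}^{\sigma,\tau}_s$ is the induced probability measure on infinite paths from $s$. For $T\subseteq S$, $\mathsf{Reach}(T)$ is the set of paths that visit $T$, and $\mathsf{Safe}(T)$ is its complement. For $T_1,T_2\subseteq S$, $T_1\,\mathsf{U}\,T_2$ is the set of paths $s_0s_1\dots$ such that for some $i\ge 0$, $s_i\in T_2$ and $s_j\in T_1$ for all $j<i$. For $S'\subseteq S$ and $q:S'\to[0,1]$, the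 quantified reachability objective $\mathsf{Reach}(q)$ has $$\mathbb{P}^{\sigma,\tau}_s(\mathsf{Reach}(q))=\sum_{t\in S'}\mathbb{P}^{\sigma,\tau}_s\big((S\setminus S')\,\mathsf{U}\,\{t\}\big)\cdot q(t).$$ For a vector $\vec\Omega=(\Omega_1,\dots,\Omega_n)$ of such objectives, the lex-value at $s$ is $${}^{\vec\Omega}\mathbf{v}^{\mathsf{lex}}(s)=\sup_\sigma\inf_\tau\big(\mathbb{P}^{\sigma,\tau}_s(\Omega_1),\dots,\mathbb{P}^{\sigma,\tau}_s(\Omega_n)\big),$$ where $\sigma$, $\tau$ range over all strategies of Max and Min, and the supremum and infimum are taken in the lexicographic order on $[0,1]^n$. Let $n\ge 1$ and let $\vec\Omega=(\Omega_1,\dots,\Omega_n)$ be an absorbing lex-objective, that is, $\Omega_i\in\{\mathsf{Reach}(S_i),\mathsf{Safe}(S_i)\}$ with $S_i$ a set of sinks for all $i$. Assume that $\Omega_n=\mathsf{Safe}(S_n)$. Let $R=\{k\le n\mid \Omega_k=\mathsf{Reach}(S_k)\}$, let $\mathsf{Zero}_k=\{s\in S\mid {}^{\vec\Omega}\mathbf{v}^{\mathsf{lex}}_k(s)=0\}$,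 and let $$F=\bigcup_{k\in R}S_k\ \cup\ \bigcap_{k\in R}\mathsf{Zero}_k$$ be the final set (with $F=S$ if $R=\emptyset$). Let $q_n:F\to[0,1]$ be given by $q_n(t)={}^{\vec\Omega}\mathbf{v}^{\mathsf{lex}}_n(t)$ for $t\in F$, and let $\vec\Omega'=(\Omega_1,\dots,\Omega_{n-1},\mathsf{Reach}(q_n))$. Then $${}^{\vec\Omega}\mathbf{v}^{\mathsf{lex}}(s)={}^{\vec\Omega'}\mathbf{v}^{\mathsf{lex}}(s)\qquad\text{for all } s\in S.$$ -/

import Mathlib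

open MeasureTheory ProbabilityTheory

/-! ### Suprema and infima in the lexicographic order on `[0,1]^n` -/

/-- The set `[0,1]^n` equipped with the lexicographic order. -/
abbrev LexCube (n : ℕ) : Type := Lex (Fin n → unitInterval)

theorem LexCube.le_iff {n : ℕ} (x y : LexCube (n + 1)) :
    x ≤ y ↔ x 0 < y 0 ∨
      (x 0 = y 0 ∧ (toLex (Fin.tail (ofLex x)) : LexCube n) ≤ toLex (Fin.tail (ofLex y))) := by
  have hlt : ∀ a b : LexCube (n + 1), a < b ↔ a 0 < b 0 ∨
      (a 0 = b 0 ∧ (toLex (Fin.tail (ofLex a)) : LexCube n) < toLex (Fin.tail (ofLex b))) := by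
    intro a b
    constructor
    · rintro ⟨i, hi, h⟩
      refine Fin.cases (motive := fun i => (∀ j, j < i → a j = b j) → a i < b i → _)
        (fun _ h => Or.inl h) (fun i hi h => Or.inr ⟨hi 0 (Fin.succ_pos i), i, ?_, h⟩) i hi h
      exact fun j hj => hi j.succ (Fin.succ_lt_succ_iff.2 hj)
    · rintro (h | ⟨h0, i, hi, h⟩)
      · exact ⟨0, fun j hj => absurd hj (Fin.not_lt_zero j), h⟩
      · refine ⟨i.succ, fun j => ?_, h⟩
        refine Fin.cases (fun _ => h0) (fun j hj => ?_) j
        exact hi j (Fin.succ_lt_succ_iff.1 hj)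
  constructor
  · intro h
    rcases h.lt_or_eq with h | h
    · rcases (hlt x y).1 h with h | ⟨h0, h⟩
      · exact Or.inl h
      · exact Or.inr ⟨h0, h.le⟩
    · subst h
      exact Or.inr ⟨rfl, le_rfl⟩
  · rintro (h | ⟨h0, h⟩)
    · exact ((hlt x y).2 (Or.inl h)).le
    · rcases h.lt_or_eq with h | h
      · exact ((hlt x y).2 (Or.inr ⟨h0, h⟩)).le
      · refine le_of_eq (funext fun i => ?_)
        exact Fin.cases h0 (fun j => congrFun h j) i

theorem LexCube.exists_isLUB {n : ℕ} (X : Set (LexCube n)) : ∃ v, IsLUB X v := by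
  induction n with
  | zero =>
    exact ⟨toLex Fin.elim0, fun x _ => le_of_eq (funext fun i => i.elim0),
      fun x _ => le_of_eq (funext fun i => i.elim0)⟩
  | succ n ih =>
    have hs : IsLUB ((fun x : LexCube (n + 1) => x 0) '' X) (sSup ((fun x => x 0) '' X)) :=
      isLUB_sSup _
    set c : unitInterval := sSup ((fun x : LexCube (n + 1) => x 0) '' X)
    obtain ⟨w, hw⟩ := ih {y | ∃ x ∈ X, x 0 = c ∧ y = toLex (Fin.tail (ofLex x))}
    refine ⟨toLex (Fin.cons c (ofLex w)), fun x hx => ?_, fun b hb => ?_⟩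
    · rw [LexCube.le_iff]
      rcases (hs.1 ⟨x, hx, rfl⟩ : x 0 ≤ c).lt_or_eq with h | h
      · exact Or.inl h
      · exact Or.inr ⟨h, hw.1 ⟨x, hx, h, rfl⟩⟩
    · have hb' : ∀ x ∈ X, x 0 < b 0 ∨ _ := fun x hx => (LexCube.le_iff x b).1 (hb hx)
      have hcb : c ≤ b 0 := hs.2 (by
        rintro _ ⟨x, hx, rfl⟩
        rcases hb' x hx with h | h
        · exact h.le
        · exact h.1.le)
      rw [LexCube.le_iff]
      rcases hcb.lt_or_eq with h | h
      · exact Or.inl h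
      · refine Or.inr ⟨h, hw.2 ?_⟩
        rintro _ ⟨x, hx, hxc, rfl⟩
        rcases hb' x hx with h' | h'
        · exact absurd (hxc.trans h) h'.ne
        · exact h'.2

theorem LexCube.exists_isGLB {n : ℕ} (X : Set (LexCube n)) : ∃ v, IsGLB X v := by
  obtain ⟨v, hv⟩ := LexCube.exists_isLUB (lowerBounds X)
  exact ⟨v, isLUB_lowerBounds.1 hv⟩

/-- The supremum of a subset of `[0,1]^n` in the lexicographic order. -/
noncomputable def lexSup {n : ℕ} (X : Set (LexCube n)) : LexCube n :=
  Classical.choose (LexCube.exists_isLUB X)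

theorem isLUB_lexSup {n : ℕ} (X : Set (LexCube n)) : IsLUB X (lexSup X) :=
  Classical.choose_spec (LexCube.exists_isLUB X)

/-- The infimum of a subset of `[0,1]^n` in the lexicographic order. -/
noncomputable def lexInf {n : ℕ} (X : Set (LexCube n)) : LexCube n :=
  Classical.choose (LexCube.exists_isGLB X)

theorem isGLB_lexInf {n : ℕ} (X : Set (LexCube n)) : IsGLB X (lexInf X) :=
  Classical.choose_spec (LexCube.exists_isGLB X)

/-! ### Stochastic games -/

/-- A turn-based stochastic game with states `S` and action labels `L`. The states outside
`maxStates` belong to player Min. The value of `trans s a` matters only for `a ∈ act s`. -/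
structure StochasticGame (S L : Type*) where
  maxStates : Set S
  act : S → Set L
  act_nonempty : ∀ s, (act s).Nonempty
  trans : S → L → PMF S

/-- One step `(s, a) ∈ S × L` of a path: a state and the action chosen in it. -/
structure PathStep (S L : Type*) where
  state : S
  action : L

instance {S L : Type*} : MeasurableSpace (PathStep S L) := ⊤

instance {S L : Type*} : DiscreteMeasurableSpace (PathStep S L) := ⟨fun _ => trivial⟩

instance {S L : Type*} [Finite S] [Finite L] : Finite (PathStep S L) :=
  Finite.of_injective (fun p => (p.state, p.action)) (by
    rintro ⟨s, a⟩ ⟨t, b⟩ h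
    simpa using h)

/-- Infinite sequences in `(S × L)^ω`. -/
abbrev InfPath (S L : Type*) : Type _ := ℕ → PathStep S L

namespace StochasticGame

variable {S L : Type*} (G : StochasticGame S L)

/-- The set of player Min's states. -/
def minStates : Set S := G.maxStatesᶜ

/-- The absorbing states. -/
def sinks : Set S := {s | ∀ a ∈ G.act s, G.trans s a s = 1}

/-- A (history-dependent, randomized) strategy of the player who owns the states in `A`: after the
history `h ∈ (S × L)^*` and in the current state `s ∈ A` it chooses an available action at random.
-/
structure Strategy (A : Set S) where
  choice : List (PathStep S L) → A → PMF L
  choice_mem : ∀ h s, ∀ a ∈ (choice h s).support, a ∈ G.act s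

abbrev MaxStrategy : Type _ := G.Strategy G.maxStates

abbrev MinStrategy : Type _ := G.Strategy G.minStates

variable {G}

open Classical in
/-- The distribution of the action played in `s` after history `h` when the players use `σ`
and `τ`. -/
noncomputable def play (σ : G.MaxStrategy) (τ : G.MinStrategy) (h : List (PathStep S L)) (s : S) :
    PMF L :=
  if hs : s ∈ G.maxStates then σ.choice h ⟨s, hs⟩ else τ.choice h ⟨s, hs⟩

/-- The distribution of the step `(s, a)` after history `h`, given that the current state is `s`. -/
noncomputable def playStep (σ : G.MaxStrategy) (τ : G.MinStrategy) (h : List (PathStep S L))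
    (s : S) : PMF (PathStep S L) :=
  (play σ τ h s).map (PathStep.mk s)

/-- The history `(s₀,a₀), …, (sₙ,aₙ)` as a list. -/
def histList {n : ℕ} (h : (i : Finset.Iic n) → PathStep S L) : List (PathStep S L) :=
  List.ofFn fun i : Fin (n + 1) => h ⟨i, Finset.mem_Iic.2 (Nat.le_of_lt_succ i.isLt)⟩

/-- Given `(s₀,a₀), …, (sₙ,aₙ)`, the next state is drawn from `P(sₙ,aₙ)`, and then the next action
by the player who owns that state. -/
noncomputable def stepKernel [Finite S] [Finite L] (σ : G.MaxStrategy) (τ : G.MinStrategy) (n : ℕ) :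
    Kernel ((i : Finset.Iic n) → PathStep S L) (PathStep S L) :=
  Kernel.ofFunOfCountable fun h =>
    ((G.trans (h ⟨n, Finset.mem_Iic.2 le_rfl⟩).state (h ⟨n, Finset.mem_Iic.2 le_rfl⟩).action).bind
      fun s => playStep σ τ (histList h) s).toMeasure

instance [Finite S] [Finite L] (σ : G.MaxStrategy) (τ : G.MinStrategy) (n : ℕ) :
    IsMarkovKernel (stepKernel σ τ n) :=
  ⟨fun h => by unfold stepKernel; exact PMF.toMeasure.isProbabilityMeasure _⟩

/-- The probability measure `ℙ_s^{σ,τ}` on infinite paths starting in `s`. -/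
noncomputable def pathMeasure [Finite S] [Finite L] (σ : G.MaxStrategy) (τ : G.MinStrategy)
    (s : S) : Measure (InfPath S L) :=
  Kernel.trajMeasure (X := fun _ => PathStep S L) (playStep σ τ [] s).toMeasure (stepKernel σ τ)

instance [Finite S] [Finite L] (σ : G.MaxStrategy) (τ : G.MinStrategy) (s : S) :
    IsProbabilityMeasure (pathMeasure σ τ s) := by
  have := PMF.toMeasure.isProbabilityMeasure (playStep σ τ [] s)
  unfold pathMeasure
  infer_instance

end StochasticGame

/-! ### Properties and objectives -/

section Properties

variable {S L : Type*}

/-- `Reach T`: some visited state is in `T`. -/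
def reachProp (T : Set S) : Set (InfPath S L) := {ω | ∃ i, (ω i).state ∈ T}

/-- `Safe T`: the set `T` is avoided forever. -/
def safeProp (T : Set S) : Set (InfPath S L) := (reachProp T)ᶜ

/-- `T₁ U T₂`: the path stays in `T₁` until it visits `T₂`. -/
def untilProp (T₁ T₂ : Set S) : Set (InfPath S L) :=
  {ω | ∃ i, (ω i).state ∈ T₂ ∧ ∀ j < i, (ω j).state ∈ T₁}

theorem measurableSet_untilProp (T₁ T₂ : Set S) :
    MeasurableSet (untilProp T₁ T₂ : Set (InfPath S L)) := by
  have h : ∀ (i : ℕ) (T : Set S), MeasurableSet {ω : InfPath S L | (ω i).state ∈ T} := fun i T =>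
    (measurable_pi_apply i : Measurable fun ω : InfPath S L => ω i)
      (MeasurableSet.of_discrete (s := {p : PathStep S L | p.state ∈ T}))
  have : (untilProp T₁ T₂ : Set (InfPath S L)) =
      ⋃ i, ({ω | (ω i).state ∈ T₂} ∩ ⋂ j, ⋂ (_ : j < i), {ω | (ω j).state ∈ T₁}) := by
    ext ω
    simp [untilProp]
  rw [this]
  exact MeasurableSet.iUnion fun i =>
    (h i T₂).inter (MeasurableSet.iInter fun j => MeasurableSet.iInter fun _ => h j T₁)

theorem disjoint_untilProp {T : Set S} {s t : S} (hs : s ∈ T) (ht : t ∈ T) (hst : s ≠ t) :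
    Disjoint (untilProp Tᶜ {s} : Set (InfPath S L)) (untilProp Tᶜ {t}) := by
  rw [Set.disjoint_left]
  rintro ω ⟨i, hi, hi'⟩ ⟨j, hj, hj'⟩
  rw [Set.mem_singleton_iff] at hi hj
  rcases lt_trichotomy i j with h | h | h
  · exact hj' i h (hi ▸ hs)
  · exact hst (hi.symm.trans ((congrArg (fun k => (ω k).state) h).trans hj))
  · exact hi' j h (hj ▸ ht)

end Properties

/-- A reachability or safety objective. -/
inductive RSObjective (S : Type*) where
  | reach (T : Set S)
  | safe (T : Set S)

/-- The set `T` of `Reach T` or `Safe T`. -/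
def RSObjective.target {S : Type*} : RSObjective S → Set S
  | reach T => T
  | safe T => T

/-- Whether the objective is a reachability objective. -/
def RSObjective.IsReach {S : Type*} : RSObjective S → Prop
  | reach _ => True
  | safe _ => False

/-- A reachability or safety objective, or a quantified reachability objective `Reach q` for
a function `q : T → [0,1]` on a set `T` of states. -/
inductive Objective (S : Type*) where
  | std (Ω : RSObjective S)
  | quantReach (T : Set S) (q : T → unitInterval)

namespace StochasticGame

variable {S L : Type*} [Fintype S] [Finite L] {G : StochasticGame S L}

/-- The probability that a property of paths holds, as an element of `[0,1]`. -/
noncomputable def propProb (σ : G.MaxStrategy) (τ : G.MinStrategy) (s : S)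
    (A : Set (InfPath S L)) : unitInterval :=
  ⟨(pathMeasure σ τ s).real A, measureReal_nonneg, measureReal_le_one⟩

open Classical in
theorem quantReach_sum_mem (σ : G.MaxStrategy) (τ : G.MinStrategy) (s : S) (T : Set S)
    (q : T → unitInterval) :
    ∑ t : T, (propProb σ τ s (untilProp Tᶜ {(t : S)}) : ℝ) * q t ∈ unitInterval := by
  refine ⟨Finset.sum_nonneg fun t _ => mul_nonneg (propProb σ τ s _).2.1 (q t).2.1, ?_⟩
  calc ∑ t : T, (propProb σ τ s (untilProp Tᶜ {(t : S)}) : ℝ) * q t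
      ≤ ∑ t : T, (pathMeasure σ τ s).real (untilProp Tᶜ {(t : S)}) :=
        Finset.sum_le_sum fun t _ => mul_le_of_le_one_right (propProb σ τ s _).2.1 (q t).2.2
    _ = (pathMeasure σ τ s).real (⋃ t : T, untilProp Tᶜ {(t : S)}) :=
        (measureReal_iUnion_fintype
          (fun a b hab => disjoint_untilProp a.2 b.2 fun h => hab (Subtype.ext h))
          fun t => measurableSet_untilProp _ _).symm
    _ ≤ 1 := measureReal_le_one

open Classical in
/-- `ℙ_s^{σ,τ}(Reach q) = ∑_{t ∈ T} ℙ_s^{σ,τ}((S \ T) U t) · q(t)` for `q : T → [0,1]`. -/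
noncomputable def quantReachProb (σ : G.MaxStrategy) (τ : G.MinStrategy) (s : S) (T : Set S)
    (q : T → unitInterval) : unitInterval :=
  ⟨∑ t : T, (propProb σ τ s (untilProp Tᶜ {(t : S)}) : ℝ) * q t, quantReach_sum_mem σ τ s T q⟩

/-- The probability of an objective from state `s` under the strategies `σ` and `τ`. -/
noncomputable def objProb (σ : G.MaxStrategy) (τ : G.MinStrategy) (s : S) :
    Objective S → unitInterval
  | .std (.reach T) => propProb σ τ s (reachProp T)
  | .std (.safe T) => propProb σ τ s (safeProp T)
  | .quantReach T q => quantReachProb σ τ s T q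

variable (G)

/-- The lex-value `sup_σ inf_τ ℙ_s^{σ,τ}(Ω)` at state `s` of a vector `Ω` of objectives, where the
supremum and the infimum range over all strategies and are taken in the lexicographic order on
`[0,1]^n`. -/
noncomputable def lexValue {n : ℕ} (Ω : Fin n → Objective S) (s : S) : LexCube n :=
  lexSup (Set.range fun σ : G.MaxStrategy =>
    lexInf (Set.range fun τ : G.MinStrategy => toLex fun i => objProb σ τ s (Ω i)))

/-- A lex-objective is absorbing if all its target sets consist of sinks. -/
def IsAbsorbing {n : ℕ} (Ω : Fin n → RSObjective S) : Prop :=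
  ∀ i, (Ω i).target ⊆ G.sinks

/-- `Zero_i`: the states whose lex-value has `i`-th component zero. -/
def zeroSet {n : ℕ} (Ω : Fin n → RSObjective S) (i : Fin n) : Set S :=
  {s | G.lexValue (fun j => .std (Ω j)) s i = 0}

/-- The final set `F = ⋃_{k ∈ R} S_k ∪ ⋂_{k ∈ R} Zero_k`, where `R` is the set of indices of
reachability objectives (the whole state space if `R = ∅`). -/
def finalSet {n : ℕ} (Ω : Fin n → RSObjective S) : Set S :=
  (⋃ k ∈ {k | (Ω k).IsReach}, (Ω k).target) ∪ ⋂ k ∈ {k | (Ω k).IsReach}, G.zeroSet Ω k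

end StochasticGame

/-! ### Expectations over finite types -/

/-! All targets lie in a set `D` of sinks, so each objective pays a constant `offset` on paths that
avoid `D` and corrects it by a `gain` that depends only on the state in which `D` is entered.
Weighting component `i` by `ε ^ i` merges the vector into one real terminal payoff. Such a game has
a memoryless deterministic saddle point (`exists_isSaddle`, as a limit of discounted games). There
are finitely many memoryless deterministic plays, so one `d` is a saddle for arbitrarily small `ε`,
and for small `ε` comparing weighted sums is comparing lexicographically. Hence `d` attains the
lex-value (`lexValue_std`).

The same `d` is a saddle for the new objective. Let `stopped` be the payoff of ending the play on
entering `F` with the old value, while avoiding `F` pays the offsets. The value is superharmonic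
when Min plays `d` and subharmonic when Max does, so `stopped` lies between the original payoff and
the value (`le_stopped_le`, `le_stopped`). The new last component is the last component of
`stopped`, except that avoiding `F` pays `0` instead of the offset. This can only hurt Max, so Min's
bound survives.

For Max one needs that never reaching `F` is no better for Min (`le_update_stopped`). Outside `F`
some reachability component has positive value. If Min could avoid `F` almost surely from there
against `d`, that component would be `0`. Optimality of `d` then forces an earlier component to
exceed its value strictly, so the last one is irrelevant. The reduction from arbitrary to memoryless
counterplay is `le_termVal_of_forall_purePlay`. -/

/-- The expectation of a real function on a finite type. -/
noncomputable def PMF.expect {α : Type*} [Fintype α] (p : PMF α) (f : α → ℝ) : ℝ :=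
  ∑ a, (p a).toReal * f a

namespace PMF

variable {α : Type*} [Fintype α] (p : PMF α)

theorem sum_toReal : ∑ a, (p a).toReal = 1 := by
  rw [← ENNReal.toReal_sum fun a _ => p.apply_ne_top a, ← tsum_fintype (L := .unconditional _),
    p.tsum_coe, ENNReal.toReal_one]

theorem expect_mono {f g : α → ℝ} (h : ∀ a ∈ p.support, f a ≤ g a) : p.expect f ≤ p.expect g := by
  refine Finset.sum_le_sum fun a _ => ?_
  by_cases ha : a ∈ p.support
  · exact mul_le_mul_of_nonneg_left (h a ha) ENNReal.toReal_nonneg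
  · rw [mem_support_iff, not_not] at ha
    simp [ha]

theorem expect_congr {f g : α → ℝ} (h : ∀ a ∈ p.support, f a = g a) : p.expect f = p.expect g :=
  le_antisymm (p.expect_mono fun a ha => (h a ha).le) (p.expect_mono fun a ha => (h a ha).ge)

@[simp] theorem expect_const (c : ℝ) : (p.expect fun _ => c) = c := by
  rw [expect, ← Finset.sum_mul, sum_toReal, one_mul]

theorem expect_add (f g : α → ℝ) : (p.expect fun a => f a + g a) = p.expect f + p.expect g := by
  simp [expect, mul_add, Finset.sum_add_distrib]

theorem expect_const_mul (c : ℝ) (f : α → ℝ) : (p.expect fun a => c * f a) = c * p.expect f := by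
  simp only [expect, Finset.mul_sum]
  exact Finset.sum_congr rfl fun a _ => by ring

theorem expect_sub (f g : α → ℝ) : (p.expect fun a => f a - g a) = p.expect f - p.expect g := by
  simp [expect, mul_sub, Finset.sum_sub_distrib]

theorem expect_pure (a : α) (f : α → ℝ) : (PMF.pure a).expect f = f a := by
  classical
  rw [expect, Finset.sum_eq_single a]
  · simp
  · intro b _ hb
    simp [PMF.pure_apply, hb]
  · simp

theorem expect_tsum {f : ℕ → α → ℝ} (h : ∀ a, Summable fun k => f k a) :
    ∑' k, p.expect (f k) = p.expect fun a => ∑' k, f k a := by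
  simp only [expect]
  rw [Summable.tsum_finsetSum fun a _ => (h a).mul_left _]
  simp_rw [tsum_mul_left]

theorem continuous_expect : Continuous p.expect := by
  unfold expect
  fun_prop

end PMF

/-! ### Terminal payoffs -/

/-- A joint behaviour of both players: an action distribution for each history and state. -/
abbrev Play (S L : Type*) : Type _ := List (PathStep S L) → S → PMF L

namespace TerminalGame

variable {S L : Type*} [Fintype S] [Fintype L] (P : S → L → PMF S) (π : Play S L)

/-- The memoryless deterministic play. -/
noncomputable def purePlay (d : S → L) : Play S L := fun _ s => PMF.pure (d s)

/-- The expectation of `Y` after one more step. -/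
noncomputable def next (Y : List (PathStep S L) → S → ℝ) (h : List (PathStep S L)) (s : S) : ℝ :=
  (π h s).expect fun a => (P s a).expect fun t => Y (h ++ [⟨s, a⟩]) t

open Classical in
/-- The expectation of `g (X_k)` on the event that `F` is visited at time `k` for the first time. -/
noncomputable def hitPay (F : Set S) (g : S → ℝ) : ℕ → List (PathStep S L) → S → ℝ
  | 0 => fun _ s => if s ∈ F then g s else 0
  | k + 1 => fun h s => if s ∈ F then 0 else next P π (hitPay F g k) h s

/-- The expectation of `r ^ k * g (X_k)`, where `k` is the time of the first visit of `F`
(and of `0` if `F` is never visited). -/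
noncomputable def termVal (r : ℝ) (F : Set S) (g : S → ℝ) (h : List (PathStep S L)) (s : S) : ℝ :=
  ∑' k, r ^ k * hitPay P π F g k h s

variable {P π} {F : Set S} {g g' : S → ℝ} {Y Y' : List (PathStep S L) → S → ℝ}
  {h : List (PathStep S L)} {s : S} {r C : ℝ}

theorem next_mono (hY : ∀ h s, Y h s ≤ Y' h s) : next P π Y h s ≤ next P π Y' h s :=
  PMF.expect_mono _ fun _ _ => PMF.expect_mono _ fun _ _ => hY _ _

theorem next_const (c : ℝ) : next P π (fun _ _ => c) h s = c := by simp [next]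

theorem next_add : next P π (fun h s => Y h s + Y' h s) h s = next P π Y h s + next P π Y' h s := by
  simp [next, PMF.expect_add]

theorem next_sub : next P π (fun h s => Y h s - Y' h s) h s = next P π Y h s - next P π Y' h s := by
  simp [next, PMF.expect_sub]

theorem next_const_mul (c : ℝ) : next P π (fun h s => c * Y h s) h s = c * next P π Y h s := by
  simp [next, PMF.expect_const_mul]

theorem next_tsum {Y : ℕ → List (PathStep S L) → S → ℝ} (hY : ∀ h s, Summable fun k => Y k h s) :
    ∑' k, next P π (Y k) h s = next P π (fun h s => ∑' k, Y k h s) h s := by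
  have hsum : ∀ a, Summable fun k => (P s a).expect fun t => Y k (h ++ [⟨s, a⟩]) t := fun a =>
    summable_sum fun t _ => (hY _ t).mul_left _
  unfold next
  rw [PMF.expect_tsum _ hsum]
  congr 1
  ext a
  exact PMF.expect_tsum _ fun t => hY _ t

theorem hitPay_mem_zero (hs : s ∈ F) : hitPay P π F g 0 h s = g s := if_pos hs

theorem hitPay_notMem_zero (hs : s ∉ F) : hitPay P π F g 0 h s = 0 := if_neg hs

theorem hitPay_mem_succ (hs : s ∈ F) (k : ℕ) : hitPay P π F g (k + 1) h s = 0 := if_pos hs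

theorem hitPay_notMem_succ (hs : s ∉ F) (k : ℕ) :
    hitPay P π F g (k + 1) h s = next P π (hitPay P π F g k) h s := if_neg hs

theorem hitPay_add (k : ℕ) : hitPay P π F (fun s => g s + g' s) k h s =
    hitPay P π F g k h s + hitPay P π F g' k h s := by
  induction k generalizing h s with
  | zero => simp only [hitPay]; split_ifs <;> simp
  | succ k ih =>
    simp only [hitPay]
    split_ifs
    · simp
    · rw [← next_add]
      simp_rw [← ih]

theorem hitPay_const_mul (c : ℝ) (k : ℕ) : hitPay P π F (fun s => c * g s) k h s =
    c * hitPay P π F g k h s := by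
  induction k generalizing h s with
  | zero => simp only [hitPay]; split_ifs <;> simp
  | succ k ih =>
    simp only [hitPay]
    split_ifs
    · simp
    · rw [← next_const_mul]
      simp_rw [← ih]

theorem hitPay_mono (hg : ∀ s ∈ F, g s ≤ g' s) (k : ℕ) :
    hitPay P π F g k h s ≤ hitPay P π F g' k h s := by
  induction k generalizing h s with
  | zero =>
    simp only [hitPay]
    split_ifs with hs
    · exact hg s hs
    · exact le_rfl
  | succ k ih =>
    simp only [hitPay]
    split_ifs
    · exact le_rfl
    · exact next_mono fun _ _ => ih

theorem hitPay_congr (hg : ∀ s ∈ F, g s = g' s) (k : ℕ) :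
    hitPay P π F g k h s = hitPay P π F g' k h s :=
  le_antisymm (hitPay_mono (fun s hs => (hg s hs).le) k) (hitPay_mono (fun s hs => (hg s hs).ge) k)

theorem hitPay_zero (k : ℕ) : hitPay P π F (fun _ => 0) k h s = 0 := by
  simpa using hitPay_const_mul (P := P) (π := π) (F := F) (h := h) (s := s) (g := fun _ => 0) 0 k

theorem hitPay_one_nonneg (k : ℕ) : 0 ≤ hitPay P π F (fun _ => 1) k h s := by
  rw [← hitPay_zero (P := P) (π := π) (F := F) (h := h) (s := s) k]
  exact hitPay_mono (fun _ _ => zero_le_one) k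

theorem abs_hitPay_le (hg : ∀ s ∈ F, |g s| ≤ C) (k : ℕ) :
    |hitPay P π F g k h s| ≤ C * hitPay P π F (fun _ => 1) k h s := by
  rw [← hitPay_const_mul, abs_le', ← neg_one_mul, ← hitPay_const_mul]
  exact ⟨hitPay_mono (fun s hs => by simpa using (le_abs_self _).trans (hg s hs)) k,
    hitPay_mono (fun s hs => by simpa using (neg_le_abs _).trans (hg s hs)) k⟩

/-- First visits at distinct times are disjoint events. From a state outside `F`, the first `n + 1`
times become the first `n` times of the successor. -/
theorem sum_hitPay_one_le (n : ℕ) :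
    ∑ k ∈ Finset.range n, hitPay P π F (fun _ => 1) k h s ≤ 1 := by
  induction n generalizing h s with
  | zero => simp
  | succ n ih =>
    rw [Finset.sum_range_succ']
    by_cases hs : s ∈ F
    · simp [hitPay_mem_zero hs, hitPay_mem_succ hs]
    · have : ∑ k ∈ Finset.range n, next P π (hitPay P π F (fun _ => 1) k) h s = next P π
          (fun h s => ∑ k ∈ Finset.range n, hitPay P π F (fun _ => 1) k h s) h s := by
        clear ih
        induction n with
        | zero => simp [next_const]
        | succ n ih => simp_rw [Finset.sum_range_succ, next_add, ih]
      simp only [hitPay_notMem_zero hs, hitPay_notMem_succ hs, this, add_zero]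
      exact (next_mono fun _ _ => ih).trans_eq (next_const 1)

theorem summable_hitPay_one : Summable fun k => hitPay P π F (fun _ => 1) k h s :=
  summable_of_sum_range_le (fun k => hitPay_one_nonneg k) sum_hitPay_one_le

theorem exists_abs_le (g : S → ℝ) : ∃ C, 0 ≤ C ∧ ∀ s, |g s| ≤ C :=
  ⟨∑ s, |g s|, Finset.sum_nonneg fun _ _ => abs_nonneg _, fun s =>
    Finset.single_le_sum (f := fun s => |g s|) (fun _ _ => abs_nonneg _) (Finset.mem_univ s)⟩

theorem abs_pow_mul_hitPay_le (hr : |r| ≤ 1) (hg : ∀ s ∈ F, |g s| ≤ C) (k : ℕ) :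
    |r ^ k * hitPay P π F g k h s| ≤ C * hitPay P π F (fun _ => 1) k h s := by
  rw [abs_mul, abs_pow]
  exact (mul_le_of_le_one_left (abs_nonneg _) (pow_le_one₀ (abs_nonneg _) hr)).trans
    (abs_hitPay_le hg k)

theorem summable_pow_mul_hitPay (hr : |r| ≤ 1) : Summable fun k => r ^ k * hitPay P π F g k h s := by
  obtain ⟨C, -, hC⟩ := exists_abs_le g
  exact Summable.of_norm_bounded (summable_hitPay_one.mul_left C)
    fun k => abs_pow_mul_hitPay_le hr (fun s _ => hC s) k

theorem termVal_add (hr : |r| ≤ 1) : termVal P π r F (fun s => g s + g' s) h s =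
    termVal P π r F g h s + termVal P π r F g' h s := by
  simp only [termVal, hitPay_add, mul_add]
  exact (summable_pow_mul_hitPay hr).tsum_add (summable_pow_mul_hitPay hr)

theorem termVal_const_mul (c : ℝ) : termVal P π r F (fun s => c * g s) h s =
    c * termVal P π r F g h s := by
  simp only [termVal, hitPay_const_mul, ← tsum_mul_left]
  congr 1
  ext k
  ring

theorem termVal_congr (hg : ∀ s ∈ F, g s = g' s) :
    termVal P π r F g h s = termVal P π r F g' h s := by
  simp only [termVal, hitPay_congr hg]

theorem termVal_sum {ι : Type*} (I : Finset ι) (hr : |r| ≤ 1) (c : ι → ℝ) (g : ι → S → ℝ) :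
    termVal P π r F (fun s => ∑ i ∈ I, c i * g i s) h s =
      ∑ i ∈ I, c i * termVal P π r F (g i) h s := by
  classical
  induction I using Finset.induction_on with
  | empty => simp [termVal, hitPay_zero]
  | insert i I hi ih =>
    simp_rw [Finset.sum_insert hi]
    rw [termVal_add hr, ih, termVal_const_mul]

theorem abs_termVal_le (hr : |r| ≤ 1) (hg : ∀ s ∈ F, |g s| ≤ C) :
    |termVal P π r F g h s| ≤ C * termVal P π 1 F (fun _ => 1) h s := by
  simp only [termVal, one_pow, one_mul, ← tsum_mul_left]
  rw [← Real.norm_eq_abs]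
  exact tsum_of_norm_bounded (summable_hitPay_one.mul_left C).hasSum
    fun k => abs_pow_mul_hitPay_le hr hg k

theorem termVal_one_nonneg : 0 ≤ termVal P π 1 F (fun _ => 1) h s :=
  tsum_nonneg fun k => by simpa using hitPay_one_nonneg k

theorem termVal_one_le : termVal P π 1 F (fun _ => 1) h s ≤ 1 := by
  simp only [termVal, one_pow, one_mul]
  exact Real.tsum_le_of_sum_range_le (fun k => hitPay_one_nonneg k) sum_hitPay_one_le

theorem termVal_mem (hs : s ∈ F) : termVal P π r F g h s = g s := by
  rw [termVal, tsum_eq_single 0, pow_zero, one_mul, hitPay_mem_zero hs]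
  rintro (_ | k) hk
  · exact absurd rfl hk
  · rw [hitPay_mem_succ hs, mul_zero]

theorem termVal_notMem (hr : |r| ≤ 1) (hs : s ∉ F) :
    termVal P π r F g h s = r * next P π (termVal P π r F g) h s := by
  rw [termVal, (summable_pow_mul_hitPay hr).tsum_eq_zero_add, hitPay_notMem_zero hs, mul_zero,
    zero_add]
  simp only [hitPay_notMem_succ hs]
  unfold termVal
  rw [← next_tsum fun _ _ => summable_pow_mul_hitPay hr, ← tsum_mul_left]
  congr 1
  ext k
  rw [next_const_mul]
  ring

/-- A function that is dominated by the probability of reaching `F`, and at each point is either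
nonpositive or dominated by its one-step expectation outside of `F`, is nonpositive. -/
theorem nonpos_of_le_next (hC : ∀ h s, Y h s ≤ C * termVal P π 1 F (fun _ => 1) h s)
    (hY : ∀ h s, Y h s ≤ 0 ∨ s ∉ F ∧ Y h s ≤ next P π Y h s) (h : List (PathStep S L)) (s : S) :
    Y h s ≤ 0 := by
  have hC' : ∀ h s, Y h s ≤ |C| * termVal P π 1 F (fun _ => 1) h s := fun h s =>
    (hC h s).trans (mul_le_mul_of_nonneg_right (le_abs_self C) termVal_one_nonneg)
  -- Iterating the one-step inequality `n` times leaves only the probability that the first visit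
  -- happens at time `n` or later, the tail of a convergent series.
  have key : ∀ n h s, Y h s ≤ |C| * ∑' k, hitPay P π F (fun _ => 1) (k + n) h s := by
    intro n
    induction n with
    | zero => simpa [termVal] using hC'
    | succ n ih =>
      intro h s
      rcases hY h s with h0 | ⟨hs, h1⟩
      · exact h0.trans (mul_nonneg (abs_nonneg C) (tsum_nonneg fun k => hitPay_one_nonneg _))
      · refine h1.trans ((next_mono ih).trans_eq ?_)
        rw [next_const_mul, ← next_tsum fun h s => (summable_nat_add_iff n).2 summable_hitPay_one]
        congr 2
        ext k
        exact (hitPay_notMem_succ hs (k + n)).symm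
  have lim := (tendsto_sum_nat_add fun k => hitPay P π F (fun _ => 1) k h s).const_mul |C|
  rw [mul_zero] at lim
  exact ge_of_tendsto' lim fun n => key n h s

/-- Each iteration gains a factor `r`, so a constant bound suffices here and no hitting probability
is needed. -/
theorem nonpos_of_le_discounted_next (hr : 0 ≤ r) (hr1 : r < 1) (hC : ∀ h s, Y h s ≤ C)
    (hY : ∀ h s, Y h s ≤ 0 ∨ Y h s ≤ r * next P π Y h s) (h : List (PathStep S L)) (s : S) :
    Y h s ≤ 0 := by
  have key : ∀ n h s, Y h s ≤ r ^ n * |C| := by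
    intro n
    induction n with
    | zero => simpa using fun h s => (hC h s).trans (le_abs_self C)
    | succ n ih =>
      intro h s
      rcases hY h s with h0 | h1
      · exact h0.trans (by positivity)
      · refine h1.trans ((mul_le_mul_of_nonneg_left (next_mono ih) hr).trans_eq ?_)
        rw [next_const]
        ring
  have lim := (tendsto_pow_atTop_nhds_zero_of_lt_one hr hr1).mul_const |C|
  rw [zero_mul] at lim
  exact ge_of_tendsto' lim fun n => key n h s

theorem termVal_one_mono {D : Set S} (hDF : D ⊆ F) :
    termVal P π 1 D (fun _ => 1) h s ≤ termVal P π 1 F (fun _ => 1) h s := by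
  rw [← sub_nonpos]
  refine nonpos_of_le_next (P := P) (π := π) (F := D) (C := 1)
    (Y := fun h s => termVal P π 1 D (fun _ => 1) h s - termVal P π 1 F (fun _ => 1) h s)
    (fun h s => ?_) (fun h s => ?_) h s
  · rw [one_mul, sub_le_self_iff]
    exact termVal_one_nonneg
  · by_cases hs : s ∈ F
    · left
      rw [termVal_mem hs, sub_nonpos]
      exact termVal_one_le
    · have hsD : s ∉ D := fun h => hs (hDF h)
      refine Or.inr ⟨hsD, ?_⟩
      rw [next_sub, termVal_notMem (by simp) hs, termVal_notMem (by simp) hsD, one_mul, one_mul]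

/-- Values bounded above by a function that is superharmonic outside of `D` lie below the values
of the game that stops with this function as payoff in a larger set. -/
theorem termVal_le_termVal_le {D : Set S} (hDF : D ⊆ F) {u : S → ℝ}
    (hu : ∀ h s, s ∉ F → next P π (fun _ => u) h s ≤ u s)
    (hle : ∀ h s, termVal P π 1 D g h s ≤ u s) (h : List (PathStep S L)) (s : S) :
    termVal P π 1 D g h s ≤ termVal P π 1 F u h s ∧ termVal P π 1 F u h s ≤ u s := by
  obtain ⟨C, hC0, hC⟩ := exists_abs_le u
  obtain ⟨C', hC0', hC'⟩ := exists_abs_le g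
  have hF : ∀ h s, |termVal P π 1 F u h s| ≤ C * termVal P π 1 F (fun _ => 1) h s := fun h s =>
    abs_termVal_le (by simp) fun s _ => hC s
  have hD : ∀ h s, |termVal P π 1 D g h s| ≤ C' * termVal P π 1 F (fun _ => 1) h s := fun h s =>
    (abs_termVal_le (by simp) fun s _ => hC' s).trans
      (mul_le_mul_of_nonneg_left (termVal_one_mono hDF) hC0')
  constructor
  · rw [← sub_nonpos]
    refine nonpos_of_le_next (P := P) (π := π) (F := F) (C := C' + C)
      (Y := fun h s => termVal P π 1 D g h s - termVal P π 1 F u h s)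
      (fun h s => ?_) (fun h s => ?_) h s
    · linarith [le_of_abs_le (hD h s), neg_le_of_abs_le (hF h s)]
    · by_cases hs : s ∈ F
      · left
        rw [termVal_mem hs, sub_nonpos]
        exact hle h s
      · refine Or.inr ⟨hs, ?_⟩
        rw [next_sub, termVal_notMem (by simp) hs, termVal_notMem (by simp) fun h => hs (hDF h),
          one_mul, one_mul]
  · rw [← sub_nonpos]
    refine nonpos_of_le_next (P := P) (π := π) (F := F) (C := C + C')
      (Y := fun h s => termVal P π 1 F u h s - u s)
      (fun h s => ?_) (fun h s => ?_) h s
    -- Superharmonicity alone is not enough, since avoiding `F` pays `0` while `u` might be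
    -- negative. The lower bound `hle` excludes this: `u` is at least a payoff collected in `D ⊆ F`,
    -- hence at least `-C'` times the probability of reaching `F`.
    · linarith [le_of_abs_le (hF h s), neg_le_of_abs_le (hD h s), hle h s]
    · by_cases hs : s ∈ F
      · left
        rw [termVal_mem hs, sub_self]
      · refine Or.inr ⟨hs, ?_⟩
        rw [next_sub (Y' := fun _ => u), termVal_notMem (by simp) hs, one_mul]
        exact sub_le_sub_left (hu h s hs) _

theorem termVal_neg : termVal P π r F (fun s => - g s) h s = - termVal P π r F g h s := by
  simpa using termVal_const_mul (P := P) (π := π) (F := F) (g := g) (h := h) (s := s) (r := r) (-1)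

theorem next_neg : next P π (fun h s => - Y h s) h s = - next P π Y h s := by
  simpa using next_const_mul (P := P) (π := π) (Y := Y) (h := h) (s := s) (-1)

theorem le_termVal_le_termVal {D : Set S} (hDF : D ⊆ F) {u : S → ℝ}
    (hu : ∀ h s, s ∉ F → u s ≤ next P π (fun _ => u) h s)
    (hle : ∀ h s, u s ≤ termVal P π 1 D g h s) (h : List (PathStep S L)) (s : S) :
    u s ≤ termVal P π 1 F u h s ∧ termVal P π 1 F u h s ≤ termVal P π 1 D g h s := by
  have := termVal_le_termVal_le (P := P) (π := π) (g := fun s => - g s) (u := fun s => - u s) hDF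
    (fun h s hs => by
      rw [next_neg (Y := fun _ => u)]
      exact neg_le_neg (hu h s hs))
    (fun h s => by
      rw [termVal_neg]
      exact neg_le_neg (hle h s)) h s
  simp only [termVal_neg, neg_le_neg_iff] at this
  exact this.symm

theorem hitPay_purePlay (d : S → L) (k : ℕ) (h h' : List (PathStep S L)) :
    hitPay P (purePlay d) F g k h s = hitPay P (purePlay d) F g k h' s := by
  induction k generalizing h h' s with
  | zero => rfl
  | succ k ih =>
    simp only [hitPay, next, purePlay, PMF.expect_pure]
    simp_rw [fun t => ih (s := t) (h ++ [⟨s, d s⟩]) (h' ++ [⟨s, d s⟩])]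

theorem termVal_purePlay (d : S → L) (h h' : List (PathStep S L)) :
    termVal P (purePlay d) r F g h s = termVal P (purePlay d) r F g h' s := by
  simp only [termVal, hitPay_purePlay d _ h h']

end TerminalGame

/-! ### Memoryless deterministic saddle points of terminal-payoff games -/

namespace TerminalGame

open Filter Topology

variable {S L : Type*} [Fintype S] [Fintype L] (P : S → L → PMF S) (M : Set S) (A : S → Set L)
  (r : ℝ) (F : Set S) (g : S → ℝ)

open Classical in
/-- The Bellman operator of the game in which Max owns `M`, the actions `A s` are available in `s`,
and the payoff `g` in `F` is discounted by `r`. -/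
noncomputable def bellman (u : S → ℝ) (s : S) : ℝ :=
  if s ∈ F then g s else
    r * if s ∈ M then ⨆ a : A s, (P s a).expect u else ⨅ a : A s, (P s a).expect u

/-- The memoryless deterministic play `d` is a saddle point of the game with payoff
`termVal P · r F g`, and its value satisfies the local optimality conditions. -/
structure IsSaddle (d : S → L) : Prop where
  mem : ∀ s, d s ∈ A s
  local_max : ∀ s ∈ M, s ∉ F → ∀ a ∈ A s, r * (P s a).expect (termVal P (purePlay d) r F g []) ≤
    termVal P (purePlay d) r F g [] s
  local_min : ∀ s ∉ M, s ∉ F → ∀ a ∈ A s, termVal P (purePlay d) r F g [] s ≤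
    r * (P s a).expect (termVal P (purePlay d) r F g [])
  le_of_max : ∀ π : Play S L, (∀ h s, ∀ a ∈ (π h s).support, a ∈ A s) →
    (∀ h, ∀ s ∈ M, π h s = PMF.pure (d s)) →
    ∀ h s, termVal P (purePlay d) r F g [] s ≤ termVal P π r F g h s
  ge_of_min : ∀ π : Play S L, (∀ h s, ∀ a ∈ (π h s).support, a ∈ A s) →
    (∀ h, ∀ s ∉ M, π h s = PMF.pure (d s)) →
    ∀ h s, termVal P π r F g h s ≤ termVal P (purePlay d) r F g [] s

variable {P M A r F g}

theorem abs_ciSup_sub_ciSup_le {ι : Type*} [Finite ι] [Nonempty ι] {f f' : ι → ℝ} {c : ℝ}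
    (hc : ∀ i, |f i - f' i| ≤ c) : |(⨆ i, f i) - ⨆ i, f' i| ≤ c := by
  have hb : ∀ f : ι → ℝ, BddAbove (Set.range f) := fun f => (Set.finite_range f).bddAbove
  rw [abs_sub_le_iff, sub_le_iff_le_add, sub_le_iff_le_add]
  constructor
  · exact ciSup_le fun i => by linarith [(abs_sub_le_iff.1 (hc i)).1, le_ciSup (hb f') i]
  · exact ciSup_le fun i => by linarith [(abs_sub_le_iff.1 (hc i)).2, le_ciSup (hb f) i]

theorem abs_ciInf_sub_ciInf_le {ι : Type*} [Finite ι] [Nonempty ι] {f f' : ι → ℝ} {c : ℝ}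
    (hc : ∀ i, |f i - f' i| ≤ c) : |(⨅ i, f i) - ⨅ i, f' i| ≤ c := by
  have hb : ∀ f : ι → ℝ, BddBelow (Set.range f) := fun f => (Set.finite_range f).bddBelow
  rw [abs_sub_le_iff, sub_le_comm, sub_le_comm (a := ⨅ i, f' i)]
  constructor
  · exact le_ciInf fun i => by linarith [(abs_sub_le_iff.1 (hc i)).1, ciInf_le (hb f) i]
  · exact le_ciInf fun i => by linarith [(abs_sub_le_iff.1 (hc i)).2, ciInf_le (hb f') i]

theorem abs_expect_sub_le (p : PMF S) (u u' : S → ℝ) : |p.expect u - p.expect u'| ≤ dist u u' := by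
  have hd : ∀ s, |u s - u' s| ≤ dist u u' := fun s => dist_le_pi_dist u u' s
  rw [← PMF.expect_sub, abs_le]
  constructor
  · rw [← p.expect_const (-dist u u')]
    exact p.expect_mono fun s _ => neg_le_of_abs_le (hd s)
  · conv_rhs => rw [← p.expect_const (dist u u')]
    exact p.expect_mono fun s _ => le_of_abs_le (hd s)

/-- Maxima, minima and expectations are nonexpansive in the sup norm, so discounting makes the
operator a contraction. -/
theorem exists_bellman_eq (hA : ∀ s, (A s).Nonempty) (hr : 0 ≤ r) (hr1 : r < 1) :
    ∃ u, bellman P M A r F g u = u := by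
  have hK : ContractingWith r.toNNReal (bellman P M A r F g) := by
    refine ⟨Real.toNNReal_lt_one.2 hr1, LipschitzWith.of_dist_le_mul fun u u' => ?_⟩
    rw [Real.coe_toNNReal r hr]
    rw [dist_pi_le_iff (mul_nonneg hr dist_nonneg)]
    intro s
    have : Nonempty (A s) := (hA s).to_subtype
    simp only [bellman, Real.dist_eq]
    split_ifs
    · simpa using mul_nonneg hr dist_nonneg
    · rw [← mul_sub, abs_mul, abs_of_nonneg hr]
      exact mul_le_mul_of_nonneg_left
        (abs_ciSup_sub_ciSup_le fun a => abs_expect_sub_le _ u u') hr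
    · rw [← mul_sub, abs_mul, abs_of_nonneg hr]
      exact mul_le_mul_of_nonneg_left
        (abs_ciInf_sub_ciInf_le fun a => abs_expect_sub_le _ u u') hr
  exact ⟨_, hK.fixedPoint_isFixedPt⟩

theorem le_termVal_of_discounted (hr : 0 ≤ r) (hr1 : r < 1) {π : Play S L} {u : S → ℝ}
    (hF : ∀ s ∈ F, u s ≤ g s) (hu : ∀ h, ∀ s ∉ F, u s ≤ r * next P π (fun _ => u) h s)
    (h : List (PathStep S L)) (s : S) : u s ≤ termVal P π r F g h s := by
  have hr' : |r| ≤ 1 := by rw [abs_of_nonneg hr]; exact hr1.le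
  obtain ⟨C, -, hC⟩ := exists_abs_le u
  obtain ⟨C', hC0', hC'⟩ := exists_abs_le g
  rw [← sub_nonpos]
  refine nonpos_of_le_discounted_next (P := P) (π := π) (C := C + C') hr hr1
    (Y := fun h s => u s - termVal P π r F g h s) (fun h s => ?_) (fun h s => ?_) h s
  · have h1 := neg_le_of_abs_le (abs_termVal_le (P := P) (π := π) (h := h) (s := s) hr'
      fun s (_ : s ∈ F) => hC' s)
    have h2 := mul_le_mul_of_nonneg_left
      (termVal_one_le (P := P) (π := π) (F := F) (h := h) (s := s)) hC0'
    linarith [le_of_abs_le (hC s)]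
  · by_cases hs : s ∈ F
    · left
      rw [termVal_mem hs]
      exact sub_nonpos.2 (hF s hs)
    · right
      rw [next_sub (Y := fun _ => u), mul_sub, termVal_notMem hr' hs]
      exact sub_le_sub_right (hu h s hs) _

theorem termVal_le_of_discounted (hr : 0 ≤ r) (hr1 : r < 1) {π : Play S L} {u : S → ℝ}
    (hF : ∀ s ∈ F, g s ≤ u s) (hu : ∀ h, ∀ s ∉ F, r * next P π (fun _ => u) h s ≤ u s)
    (h : List (PathStep S L)) (s : S) : termVal P π r F g h s ≤ u s := by
  have := le_termVal_of_discounted (P := P) (F := F) (g := fun s => - g s) (u := fun s => - u s)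
    hr hr1 (π := π) (fun s hs => neg_le_neg (hF s hs)) (fun h s hs => by
      rw [next_neg (Y := fun _ => u), mul_neg]
      exact neg_le_neg (hu h s hs)) h s
  rwa [termVal_neg, neg_le_neg_iff] at this

/-- The choice `d` attains the maximum or minimum in the Bellman equation. Each player who follows
`d` makes the fixed point a sub- or supersolution along any play of the opponent, and the discounted
comparison turns this into a guarantee. -/
theorem exists_isSaddle_of_lt_one (hA : ∀ s, (A s).Nonempty) (hr : 0 ≤ r) (hr1 : r < 1) :
    ∃ d, IsSaddle P M A r F g d := by
  classical
  obtain ⟨u, hu⟩ := exists_bellman_eq (P := P) (M := M) (F := F) (g := g) hA hr hr1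
  have hmax : ∀ s, ∃ a : A s, (P s a).expect u = ⨆ a : A s, (P s a).expect u := fun s =>
    have : Nonempty (A s) := (hA s).to_subtype
    exists_eq_ciSup_of_finite
  have hmin : ∀ s, ∃ a : A s, (P s a).expect u = ⨅ a : A s, (P s a).expect u := fun s =>
    have : Nonempty (A s) := (hA s).to_subtype
    exists_eq_ciInf_of_finite
  choose dmax hdmax using hmax
  choose dmin hdmin using hmin
  let d : S → L := fun s => if s ∈ M then dmax s else dmin s
  have hmem : ∀ s, d s ∈ A s := fun s => by
    by_cases hs : s ∈ M
    · simp [d, hs]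
    · simp [d, hs]
  have huF : ∀ s ∈ F, u s = g s := fun s hs => by
    rw [← congrFun hu s, bellman, if_pos hs]
  have hud : ∀ s ∉ F, u s = r * (P s (d s)).expect u := fun s hs => by
    conv_lhs => rw [← congrFun hu s, bellman, if_neg hs]
    by_cases hM : s ∈ M
    · simp only [d, hM, if_true, hdmax]
    · simp only [d, hM, if_false, hdmin]
  have hloc_max : ∀ s ∈ M, s ∉ F → ∀ a ∈ A s, r * (P s a).expect u ≤ u s := by
    intro s hM hs a ha
    conv_rhs => rw [← congrFun hu s, bellman, if_neg hs, if_pos hM]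
    exact mul_le_mul_of_nonneg_left (le_ciSup (f := fun a : A s => (P s a).expect u)
      (Set.finite_range _).bddAbove ⟨a, ha⟩) hr
  have hloc_min : ∀ s ∉ M, s ∉ F → ∀ a ∈ A s, u s ≤ r * (P s a).expect u := by
    intro s hM hs a ha
    conv_lhs => rw [← congrFun hu s, bellman, if_neg hs, if_neg hM]
    exact mul_le_mul_of_nonneg_left (ciInf_le (f := fun a : A s => (P s a).expect u)
      (Set.finite_range _).bddBelow ⟨a, ha⟩) hr
  have hle : ∀ π : Play S L, (∀ h s, ∀ a ∈ (π h s).support, a ∈ A s) →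
      (∀ h, ∀ s ∈ M, π h s = PMF.pure (d s)) → ∀ h s, u s ≤ termVal P π r F g h s := by
    intro π hπ hM
    refine le_termVal_of_discounted hr hr1 (fun s hs => (huF s hs).le) fun h s hs => ?_
    by_cases hsM : s ∈ M
    · rw [next, hM h s hsM, PMF.expect_pure]
      exact (hud s hs).le
    · rw [next, ← PMF.expect_const_mul]
      conv_lhs => rw [← (π h s).expect_const (u s)]
      exact PMF.expect_mono _ fun a ha => hloc_min s hsM hs a (hπ h s a ha)
  have hge : ∀ π : Play S L, (∀ h s, ∀ a ∈ (π h s).support, a ∈ A s) →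
      (∀ h, ∀ s ∉ M, π h s = PMF.pure (d s)) → ∀ h s, termVal P π r F g h s ≤ u s := by
    intro π hπ hM
    refine termVal_le_of_discounted hr hr1 (fun s hs => (huF s hs).ge) fun h s hs => ?_
    by_cases hsM : s ∈ M
    · rw [next, ← PMF.expect_const_mul]
      conv_rhs => rw [← (π h s).expect_const (u s)]
      exact PMF.expect_mono _ fun a ha => hloc_max s hsM hs a (hπ h s a ha)
    · rw [next, hM h s hsM, PMF.expect_pure]
      exact (hud s hs).ge
  -- When both players follow `d`, both guarantees apply, which identifies the fixed point with the
  -- payoff of `d`.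
  have hd : termVal P (purePlay d) r F g [] = u := by
    have hsupp : ∀ (h : List (PathStep S L)) s, ∀ a ∈ (purePlay d h s).support, a ∈ A s := by
      intro h s a ha
      rw [purePlay, PMF.support_pure, Set.mem_singleton_iff] at ha
      exact ha ▸ hmem s
    ext s
    exact le_antisymm (hge _ hsupp (fun _ _ _ => rfl) [] s) (hle _ hsupp (fun _ _ _ => rfl) [] s)
  refine ⟨d, hmem, ?_, ?_, ?_, ?_⟩
  all_goals rwa [hd]

theorem frequently_of_forall_exists {α β : Type*} [Finite β] {l : Filter α} [l.NeBot]
    {p : α → β → Prop} (hp : ∀ᶠ x in l, ∃ y, p x y) : ∃ y, ∃ᶠ x in l, p x y := by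
  by_contra! hcon
  obtain ⟨x, ⟨y, hy⟩, hx⟩ := (hp.and (eventually_all.2 hcon)).exists
  exact hx y hy

/-- Dominated convergence: the series is bounded termwise by a multiple of the summable first-visit
probabilities. -/
theorem tendsto_termVal {π : Play S L} {h : List (PathStep S L)} {s : S} :
    Tendsto (fun r => termVal P π r F g h s) (𝓝[<] 1) (𝓝 (termVal P π 1 F g h s)) := by
  obtain ⟨C, -, hC⟩ := exists_abs_le g
  refine tendsto_tsum_of_dominated_convergence
    ((summable_hitPay_one (P := P) (π := π) (F := F) (h := h) (s := s)).mul_left C)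
    (fun k => ?_) ?_
  · exact ((continuous_id.pow k).mul continuous_const).continuousWithinAt
  · have h1 : ∀ᶠ r : ℝ in 𝓝[<] 1, 0 < r :=
      nhdsWithin_le_nhds (lt_mem_nhds one_pos)
    filter_upwards [h1, self_mem_nhdsWithin] with r hr hr1 k
    refine abs_pow_mul_hitPay_le ?_ (fun s _ => hC s) k
    rw [abs_of_pos hr]
    exact le_of_lt hr1

/-- By pigeonhole one `d` is a saddle for discount factors arbitrarily close to `1`. Apart from the
choice of available actions, all saddle conditions are weak inequalities between quantities that
converge as `r` tends to `1`, so they hold in the limit. -/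
theorem exists_isSaddle (P : S → L → PMF S) (M : Set S) {A : S → Set L}
    (hA : ∀ s, (A s).Nonempty) (F : Set S) (g : S → ℝ) : ∃ d, IsSaddle P M A 1 F g d := by
  have h1 : ∀ᶠ r : ℝ in 𝓝[<] 1, ∃ d, IsSaddle P M A r F g d := by
    have h1 : ∀ᶠ r : ℝ in 𝓝[<] 1, 0 < r := nhdsWithin_le_nhds (lt_mem_nhds one_pos)
    filter_upwards [h1, self_mem_nhdsWithin] with r hr hr1
    exact exists_isSaddle_of_lt_one hA hr.le hr1
  obtain ⟨d, hd⟩ := frequently_of_forall_exists h1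
  have hv : Tendsto (fun r => termVal P (purePlay d) r F g []) (𝓝[<] 1)
      (𝓝 (termVal P (purePlay d) 1 F g [])) := tendsto_pi_nhds.2 fun s => tendsto_termVal
  have hr : Tendsto (fun r : ℝ => r) (𝓝[<] 1) (𝓝 1) := nhdsWithin_le_nhds
  have hE : ∀ s a, Tendsto (fun r => termVal P (purePlay d) r F g [] s -
      r * (P s a).expect (termVal P (purePlay d) r F g [])) (𝓝[<] 1)
      (𝓝 (termVal P (purePlay d) 1 F g [] s -
        1 * (P s a).expect (termVal P (purePlay d) 1 F g []))) := fun s a =>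
    tendsto_termVal.sub (hr.mul (((P s a).continuous_expect.tendsto _).comp hv))
  refine ⟨d, hd.exists.choose_spec.mem, fun s hM hs a ha => ?_, fun s hM hs a ha => ?_,
    fun π hπ hM h s => ?_, fun π hπ hM h s => ?_⟩
  · rw [← sub_nonneg]
    exact ge_of_tendsto_of_frequently (hE s a)
      (hd.mono fun r hd => sub_nonneg.2 (hd.local_max s hM hs a ha))
  · rw [← sub_nonpos]
    exact le_of_tendsto_of_frequently (hE s a)
      (hd.mono fun r hd => sub_nonpos.2 (hd.local_min s hM hs a ha))
  · rw [← sub_nonneg]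
    exact ge_of_tendsto_of_frequently (tendsto_termVal.sub tendsto_termVal)
      (hd.mono fun r hd => sub_nonneg.2 (hd.le_of_max π hπ hM h s))
  · rw [← sub_nonneg]
    exact ge_of_tendsto_of_frequently (tendsto_termVal.sub tendsto_termVal)
      (hd.mono fun r hd => sub_nonneg.2 (hd.ge_of_min π hπ hM h s))

end TerminalGame

/-! ### Lexicographic comparison through small weights -/

open Filter Topology in
theorem eventually_sum_pow_mul_pos {n : ℕ} {x : Fin n → ℝ} {i : Fin n} (h0 : ∀ j < i, x j = 0)
    (hi : 0 < x i) : ∀ᶠ ε : ℝ in 𝓝[>] 0, 0 < ∑ j : Fin n, ε ^ (j : ℕ) * x j := by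
  -- This is the sum divided by `ε ^ i`, which tends to `x i`. The truncated exponent for `j < i` is
  -- harmless because `x j = 0` there.
  have hc : Continuous fun ε : ℝ => ∑ j : Fin n, ε ^ ((j : ℕ) - i) * x j := by fun_prop
  have hv : ∑ j : Fin n, (0 : ℝ) ^ ((j : ℕ) - i) * x j = x i := by
    rw [Finset.sum_eq_single i]
    · simp
    · intro j _ hj
      rcases lt_or_gt_of_ne hj with h | h
      · rw [h0 j h, mul_zero]
      · have : (j : ℕ) - i ≠ 0 := Nat.sub_ne_zero_of_lt h
        rw [zero_pow this, zero_mul]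
    · simp
  have hp : ∀ᶠ ε : ℝ in 𝓝[>] 0, 0 < ∑ j : Fin n, ε ^ ((j : ℕ) - i) * x j :=
    nhdsWithin_le_nhds (hc.continuousAt.eventually (lt_mem_nhds (hi.trans_eq hv.symm)))
  filter_upwards [hp, self_mem_nhdsWithin] with ε hε hε0
  have : ∑ j : Fin n, ε ^ (j : ℕ) * x j = ε ^ (i : ℕ) * ∑ j : Fin n, ε ^ ((j : ℕ) - i) * x j := by
    rw [Finset.mul_sum]
    refine Finset.sum_congr rfl fun j _ => ?_
    rcases lt_or_ge j i with h | h
    · rw [h0 j h, mul_zero, mul_zero, mul_zero]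
    · rw [← mul_assoc, ← pow_add, Nat.add_sub_cancel' h]
  rw [this]
  exact mul_pos (pow_pos hε0 _) hε

open Filter Topology in
theorem toLex_le_of_frequently {n : ℕ} {x y : Fin n → ℝ}
    (h : ∃ᶠ ε : ℝ in 𝓝[>] 0, ∑ j : Fin n, ε ^ (j : ℕ) * x j ≤ ∑ j : Fin n, ε ^ (j : ℕ) * y j) :
    toLex x ≤ toLex y := by
  by_contra hlt
  obtain ⟨i, h0, hi⟩ := not_le.1 hlt
  have := eventually_sum_pow_mul_pos (x := fun j => x j - y j) (i := i)
    (fun j hj => sub_eq_zero.2 (h0 j hj).symm) (sub_pos.2 hi)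
  refine h (this.mono fun ε hε => ?_)
  simp only [mul_sub, Finset.sum_sub_distrib] at hε
  linarith

open Filter Topology in
theorem eventually_le_of_toLex_le {n : ℕ} {x y : Fin n → ℝ} (h : toLex x ≤ toLex y) :
    ∀ᶠ ε : ℝ in 𝓝[>] 0, ∑ j : Fin n, ε ^ (j : ℕ) * x j ≤ ∑ j : Fin n, ε ^ (j : ℕ) * y j := by
  rcases h.lt_or_eq with ⟨i, h0, hi⟩ | h
  · have := eventually_sum_pow_mul_pos (x := fun j => y j - x j) (i := i)
      (fun j hj => sub_eq_zero.2 (h0 j hj).symm) (sub_pos.2 hi)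
    refine this.mono fun ε hε => ?_
    simp only [mul_sub, Finset.sum_sub_distrib] at hε
    linarith
  · rw [toLex_inj.1 h]
    exact Eventually.of_forall fun ε => le_rfl

theorem toLex_coe_le_iff {n : ℕ} {x y : Fin n → unitInterval} :
    toLex (fun i => (x i : ℝ)) ≤ toLex (fun i => (y i : ℝ)) ↔ toLex x ≤ toLex y := by
  rw [← not_lt, ← not_lt, not_iff_not]
  constructor
  · rintro ⟨i, h0, hi⟩
    exact ⟨i, fun j hj => Subtype.ext (h0 j hj), hi⟩
  · rintro ⟨i, h0, hi⟩
    exact ⟨i, fun j hj => congrArg Subtype.val (h0 j hj), hi⟩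

section Sandwich

variable {n : ℕ} {x y v : Fin (n + 1) → ℝ} {r : ℝ}

/-- A common prefix of the two outer vectors squeezes the middle one, coordinate by coordinate. -/
theorem eq_of_toLex_le_of_toLex_le {m : ℕ} {x y v : Fin m → ℝ} (hxy : toLex x ≤ toLex y)
    (hyv : toLex y ≤ toLex v) (i : Fin m) (h : ∀ j < i, x j = v j) : ∀ j < i, y j = v j := by
  intro j
  induction j using WellFoundedLT.induction with
  | ind j ih =>
    intro hj
    have hy : ∀ k < j, y k = v k := fun k hk => ih k hk (hk.trans hj)
    refine le_antisymm (Pi.apply_le_of_toLex hyv hy) ?_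
    rw [← h j hj]
    exact Pi.apply_le_of_toLex hxy fun k hk => (h k (hk.trans hj)).trans (hy k hk).symm

/-- If `x ≤ y ≤ v` lexicographically, then the last component of `x` may be replaced by a number
that is at most the last component of `y`. -/
theorem toLex_update_last_le (hxy : toLex x ≤ toLex y) (hyv : toLex y ≤ toLex v)
    (hr : r ≤ y (Fin.last n)) : toLex (Function.update x (Fin.last n) r) ≤ toLex v := by
  by_contra hlt
  obtain ⟨i, h0, hi⟩ := not_le.1 hlt
  simp only [Pi.toLex_apply] at h0 hi
  have hx : ∀ j < i, x j = v j := fun j hj => by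
    rw [h0 j hj, Function.update_of_ne (hj.trans_le (Fin.le_last i)).ne]
  -- A first difference before the last index does not see the replacement. At the last index, `x`
  -- and `v` share their prefix, so `y` does too, and `r ≤ y (Fin.last n) ≤ v (Fin.last n)`.
  rcases (Fin.le_last i).lt_or_eq with hil | rfl
  · rw [Function.update_of_ne hil.ne] at hi
    exact hi.not_ge (Pi.apply_le_of_toLex (hxy.trans hyv) hx)
  · rw [Function.update_self] at hi
    exact (hi.trans_le hr).not_ge
      (Pi.apply_le_of_toLex hyv (eq_of_toLex_le_of_toLex_le hxy hyv _ hx))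

theorem le_toLex_update_last (hvy : toLex v ≤ toLex y) (hyx : toLex y ≤ toLex x)
    (hr : toLex v ≤ toLex (Function.update y (Fin.last n) r)) :
    toLex v ≤ toLex (Function.update x (Fin.last n) r) := by
  by_contra hlt
  obtain ⟨i, h0, hi⟩ := not_le.1 hlt
  simp only [Pi.toLex_apply] at h0 hi
  have hx : ∀ j < i, v j = x j := fun j hj => by
    rw [← h0 j hj, Function.update_of_ne (hj.trans_le (Fin.le_last i)).ne]
  rcases (Fin.le_last i).lt_or_eq with hil | rfl
  · rw [Function.update_of_ne hil.ne] at hi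
    exact hi.not_ge (Pi.apply_le_of_toLex (hvy.trans hyx) hx)
  · rw [Function.update_self] at hi
    refine hi.not_ge ?_
    rw [← Function.update_self (Fin.last n) r y]
    refine Pi.apply_le_of_toLex hr fun j hj => ?_
    rw [Function.update_of_ne hj.ne, hx j hj]
    exact (eq_of_toLex_le_of_toLex_le hvy hyx _ hx j hj).symm

end Sandwich

/-! ### The path measure expressed through first-visit payoffs -/

namespace PMF

variable {α β : Type*} [Fintype α] [Fintype β]

theorem expect_bind (p : PMF α) (q : α → PMF β) (f : β → ℝ) :
    (p.bind q).expect f = p.expect fun a => (q a).expect f := by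
  have : ∀ b, ((p.bind q) b).toReal = ∑ a, (p a).toReal * (q a b).toReal := fun b => by
    rw [bind_apply, tsum_fintype, ENNReal.toReal_sum fun a _ =>
      ENNReal.mul_ne_top (p.apply_ne_top a) ((q a).apply_ne_top b)]
    simp only [ENNReal.toReal_mul]
  simp only [expect, this, Finset.sum_mul, Finset.mul_sum]
  rw [Finset.sum_comm]
  simp only [mul_assoc]

theorem expect_map (p : PMF α) (e : α → β) (f : β → ℝ) :
    (p.map e).expect f = p.expect fun a => f (e a) := by
  rw [← bind_pure_comp, expect_bind]
  simp only [Function.comp_apply, expect_pure]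

theorem integral_toMeasure [MeasurableSpace α] [MeasurableSingletonClass α] (p : PMF α)
    (f : α → ℝ) : ∫ a, f a ∂p.toMeasure = p.expect f := by
  simp [integral_eq_sum, expect]

end PMF

theorem reachProp_eq_untilProp {S L : Type*} (T : Set S) :
    (reachProp T : Set (InfPath S L)) = untilProp Tᶜ T := by
  classical
  ext ω
  constructor
  · intro h
    exact ⟨Nat.find h, Nat.find_spec h, fun j hj => Nat.find_min h hj⟩
  · rintro ⟨i, hi, -⟩
    exact ⟨i, hi⟩

theorem measurableSet_first_visit {S L : Type*} (T F : Set S) (k : ℕ) :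
    MeasurableSet {ω : InfPath S L | (ω k).state ∈ T ∧ ∀ j < k, (ω j).state ∈ Fᶜ} := by
  have hst : ∀ (i : ℕ) (T : Set S), MeasurableSet {ω : InfPath S L | (ω i).state ∈ T} :=
    fun i T => (measurable_pi_apply i : Measurable fun ω : InfPath S L => ω i)
      (MeasurableSet.of_discrete (s := {p : PathStep S L | p.state ∈ T}))
  have : {ω : InfPath S L | (ω k).state ∈ T ∧ ∀ j < k, (ω j).state ∈ Fᶜ} =
      {ω | (ω k).state ∈ T} ∩ ⋂ j, ⋂ (_ : j < k), {ω | (ω j).state ∈ Fᶜ} := by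
    ext ω
    simp
  rw [this]
  exact (hst k T).inter (MeasurableSet.iInter fun j => MeasurableSet.iInter fun _ => hst j _)

namespace StochasticGame

open TerminalGame

variable {S L : Type*} [Fintype S] [Fintype L] {G : StochasticGame S L}

theorem map_frestrictLe_zero_pathMeasure (σ : G.MaxStrategy) (τ : G.MinStrategy) (s : S) :
    (pathMeasure σ τ s).map (fun ω => ω 0) = (playStep σ τ [] s).toMeasure := by
  have h : (fun ω : InfPath S L => ω 0) = (fun x : (i : Finset.Iic 0) → PathStep S L =>
      x ⟨0, Finset.mem_Iic.2 le_rfl⟩) ∘ Preorder.frestrictLe (π := fun _ => PathStep S L) 0 := rfl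
  rw [h, ← Measure.map_map (by fun_prop) (by fun_prop), pathMeasure, Kernel.trajMeasure,
    Measure.map_comp _ _ (by fun_prop), Kernel.traj_map_frestrictLe, Kernel.partialTraj_self,
    Measure.id_comp, Measure.map_map (by fun_prop) (by fun_prop)]
  exact Measure.map_id

open Classical in
/-- The expectation of `g (X_k)` on the event that `F` is first visited after `k` more steps, given
that the last step is `x` and the previous ones are `h`. -/
noncomputable def stepPay (σ : G.MaxStrategy) (τ : G.MinStrategy) (F : Set S) (g : S → ℝ) (k : ℕ)
    (h : List (PathStep S L)) (x : PathStep S L) : ℝ :=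
  match k with
  | 0 => if x.state ∈ F then g x.state else 0
  | k + 1 => if x.state ∈ F then 0 else (G.trans x.state x.action).expect fun t =>
      hitPay G.trans (play σ τ) F g k (h ++ [x]) t

theorem expect_stepPay (σ : G.MaxStrategy) (τ : G.MinStrategy) (F : Set S) (g : S → ℝ) (k : ℕ)
    (h : List (PathStep S L)) (s : S) :
    (play σ τ h s).expect (fun a => stepPay σ τ F g k h ⟨s, a⟩) =
      hitPay G.trans (play σ τ) F g k h s := by
  cases k with
  | zero =>
    simp only [stepPay, hitPay]
    split_ifs <;> simp
  | succ k =>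
    simp only [stepPay, hitPay]
    split_ifs
    · simp
    · rfl

/-- The initial segment of a path. -/
def initSteps (M : ℕ) (ω : InfPath S L) : List (PathStep S L) := List.ofFn fun i : Fin M => ω i

open Classical in
-- The step at time `M + 1` is integrated out with the step kernel, which moves one step from the
-- sampled path into the recursion for `hitPay`.
theorem integral_stepPay_succ (σ : G.MaxStrategy) (τ : G.MinStrategy) (F : Set S) (g : S → ℝ)
    (k M : ℕ) (s : S) :
    ∫ ω, (if ∀ j < M + 1, (ω j).state ∉ F then stepPay σ τ F g k (initSteps (M + 1) ω) (ω (M + 1))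
      else 0) ∂pathMeasure σ τ s =
    ∫ ω, (if ∀ j < M, (ω j).state ∉ F then stepPay σ τ F g (k + 1) (initSteps M ω) (ω M)
      else 0) ∂pathMeasure σ τ s := by
  let _ : Fintype (PathStep S L) := Fintype.ofFinite _
  let Φ : ((i : Finset.Iic M) → PathStep S L) × PathStep S L → ℝ := fun p =>
    if ∀ j, ∀ hj : j < M + 1, (p.1 ⟨j, Finset.mem_Iic.2 (Nat.le_of_lt_succ hj)⟩).state ∉ F then
      stepPay σ τ F g k (histList p.1) p.2 else 0
  have hΦ : Measurable Φ := measurable_of_finite Φ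
  calc _ = ∫ ω, Φ (Preorder.frestrictLe M ω, ω (M + 1)) ∂pathMeasure σ τ s := rfl
    _ = ∫ p, Φ p ∂(pathMeasure σ τ s).map
          (fun ω => (Preorder.frestrictLe (π := fun _ => PathStep S L) M ω, ω (M + 1))) :=
        (integral_map (by fun_prop) hΦ.aestronglyMeasurable).symm
    _ = ∫ p, Φ p ∂((pathMeasure σ τ s).map
          (Preorder.frestrictLe (π := fun _ => PathStep S L) M) ⊗ₘ stepKernel σ τ M) := by
        have := PMF.toMeasure.isProbabilityMeasure (playStep σ τ [] s)
        rw [pathMeasure, Kernel.map_frestrictLe_trajMeasure_compProd_eq_map_trajMeasure]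
    _ = ∫ h, ∫ x, Φ (h, x) ∂stepKernel σ τ M h ∂(pathMeasure σ τ s).map
          (Preorder.frestrictLe (π := fun _ => PathStep S L) M) := by
        have : IsProbabilityMeasure ((pathMeasure σ τ s).map
          (Preorder.frestrictLe (π := fun _ => PathStep S L) M)) :=
          Measure.isProbabilityMeasure_map (by fun_prop)
        exact Measure.integral_compProd Integrable.of_finite
    _ = ∫ ω, ∫ x, Φ (Preorder.frestrictLe M ω, x) ∂stepKernel σ τ M (Preorder.frestrictLe M ω)
          ∂pathMeasure σ τ s :=
        integral_map (by fun_prop) (measurable_of_finite _).aestronglyMeasurable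
    _ = _ := by
        congr 1
        ext ω
        have hhist : histList (Preorder.frestrictLe (π := fun _ => PathStep S L) M ω) =
            initSteps M ω ++ [ω M] := by
          rw [histList, List.ofFn_succ_last]
          rfl
        have hcond : (∀ j < M + 1, (ω j).state ∉ F) ↔
            (∀ j < M, (ω j).state ∉ F) ∧ (ω M).state ∉ F := Nat.forall_lt_succ_right
        change ∫ x, (if ∀ j < M + 1, (ω j).state ∉ F then stepPay σ τ F g k
            (histList (Preorder.frestrictLe (π := fun _ => PathStep S L) M ω)) x else 0)
          ∂(PMF.bind (G.trans (ω M).state (ω M).action) fun s => playStep σ τ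
            (histList (Preorder.frestrictLe (π := fun _ => PathStep S L) M ω)) s).toMeasure = _
        rw [hhist, PMF.integral_toMeasure, PMF.expect_bind]
        simp only [playStep, PMF.expect_map]
        simp only [hcond]
        by_cases h1 : ∀ j < M, (ω j).state ∉ F
        · by_cases h2 : (ω M).state ∉ F
          · simp only [if_pos (And.intro h1 h2), expect_stepPay]
            rw [if_pos h1, stepPay, if_neg h2]
          · simp only [if_neg (fun h => h2 h.2 : ¬((∀ j < M, (ω j).state ∉ F) ∧ (ω M).state ∉ F)),
              PMF.expect_const]
            rw [if_pos h1, stepPay, if_pos (not_not.1 h2)]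
        · simp only [if_neg h1, if_neg (fun h => h1 h.1 :
            ¬((∀ j < M, (ω j).state ∉ F) ∧ (ω M).state ∉ F)), PMF.expect_const]

theorem measureReal_first_visit (σ : G.MaxStrategy) (τ : G.MinStrategy) {F T : Set S} (hT : T ⊆ F)
    (k : ℕ) (s : S) :
    (pathMeasure σ τ s).real {ω | (ω k).state ∈ T ∧ ∀ j < k, (ω j).state ∈ Fᶜ} =
      hitPay G.trans (play σ τ) F (T.indicator 1) k [] s := by
  classical
  let _ : Fintype (PathStep S L) := Fintype.ofFinite _
  -- Of `k + M` steps, `M` are read off the path and `k` are left to the recursion. The claim needs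
  -- `k = 0`, and the induction trades it down to `M = 0`.
  have key : ∀ k M, ∫ ω, (if ∀ j < M, (ω j).state ∉ F then
        stepPay σ τ F (T.indicator 1) k (initSteps M ω) (ω M) else 0) ∂pathMeasure σ τ s =
      hitPay G.trans (play σ τ) F (T.indicator 1) (k + M) [] s := by
    intro k M
    induction M generalizing k with
    | zero =>
      rw [← expect_stepPay, ← PMF.expect_map, ← playStep, ← PMF.integral_toMeasure,
        ← map_frestrictLe_zero_pathMeasure, integral_map
          (measurable_pi_apply 0).aemeasurable (measurable_of_finite _).aestronglyMeasurable]
      simp [initSteps]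
    | succ M ih => rw [integral_stepPay_succ, ih, add_right_comm, add_assoc]
  rw [← integral_indicator_one (measurableSet_first_visit T F k), ← zero_add k, ← key 0 k, zero_add]
  congr 1
  ext ω
  by_cases h1 : ∀ j < k, (ω j).state ∉ F
  · by_cases h2 : (ω k).state ∈ T
    · simp [Set.indicator, h2, stepPay, hT h2]
    · simp [Set.indicator, h2, stepPay]
  · simp [Set.indicator, h1]

theorem measureReal_untilProp (σ : G.MaxStrategy) (τ : G.MinStrategy) {F T : Set S} (hT : T ⊆ F)
    (s : S) : (pathMeasure σ τ s).real (untilProp Fᶜ T) =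
      termVal G.trans (play σ τ) 1 F (T.indicator 1) [] s := by
  have hU : (untilProp Fᶜ T : Set (InfPath S L)) =
      ⋃ k, {ω | (ω k).state ∈ T ∧ ∀ j < k, (ω j).state ∈ Fᶜ} := by
    ext ω
    simp [untilProp]
  have hdisj : Pairwise (Function.onFun Disjoint fun k =>
      {ω : InfPath S L | (ω k).state ∈ T ∧ ∀ j < k, (ω j).state ∈ Fᶜ}) := by
    refine (pairwise_disjoint_on _).2 fun i j hij => ?_
    rw [Set.disjoint_left]
    exact fun ω hi hj => hj.2 i hij (hT hi.1)
  rw [hU, measureReal_def, measure_iUnion hdisj (measurableSet_first_visit T F), ENNReal.tsum_toReal_eq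
    fun k => measure_ne_top _ _]
  simp only [termVal, one_pow, one_mul, ← measureReal_first_visit σ τ hT, measureReal_def]

end StochasticGame

/-! ### One-step inequalities at a saddle, and reduction to memoryless counterplay -/

namespace TerminalGame

theorem support_purePlay {S L : Type*} {A : S → Set L} {d : S → L} (hd : ∀ s, d s ∈ A s) (h : List (PathStep S L)) (s : S) :
    ∀ a ∈ (purePlay d h s).support, a ∈ A s := by
  intro a ha
  rw [purePlay, PMF.support_pure, Set.mem_singleton_iff] at ha
  exact ha ▸ hd s

variable {S L : Type*} [Fintype S] [Fintype L] {P : S → L → PMF S} {M : Set S} {A : S → Set L}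
  {F : Set S} {g : S → ℝ} {d : S → L} {π : Play S L}

theorem termVal_purePlay_eq_expect {s : S} (hs : s ∉ F) :
    termVal P (purePlay d) 1 F g [] s =
      (P s (d s)).expect (termVal P (purePlay d) 1 F g []) := by
  rw [termVal_notMem (by simp) hs, one_mul, next, purePlay, PMF.expect_pure]
  congr 1
  ext t
  exact termVal_purePlay d _ _

/-- Min's moves follow `d` and preserve the value in expectation. Max's moves cannot raise it, by
local optimality of each available action. -/
theorem IsSaddle.next_le (hd : IsSaddle P M A 1 F g d)
    (hπ : ∀ h s, ∀ a ∈ (π h s).support, a ∈ A s) (hM : ∀ h, ∀ s ∉ M, π h s = PMF.pure (d s))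
    (h : List (PathStep S L)) {s : S} (hs : s ∉ F) :
    next P π (fun _ => termVal P (purePlay d) 1 F g []) h s ≤
      termVal P (purePlay d) 1 F g [] s := by
  by_cases hsM : s ∈ M
  · conv_rhs => rw [← (π h s).expect_const (termVal P (purePlay d) 1 F g [] s)]
    refine PMF.expect_mono _ fun a ha => ?_
    simpa using hd.local_max s hsM hs a (hπ h s a ha)
  · rw [next, hM h s hsM, PMF.expect_pure]
    exact (termVal_purePlay_eq_expect hs).ge

theorem IsSaddle.le_next (hd : IsSaddle P M A 1 F g d)
    (hπ : ∀ h s, ∀ a ∈ (π h s).support, a ∈ A s) (hM : ∀ h, ∀ s ∈ M, π h s = PMF.pure (d s))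
    (h : List (PathStep S L)) {s : S} (hs : s ∉ F) :
    termVal P (purePlay d) 1 F g [] s ≤
      next P π (fun _ => termVal P (purePlay d) 1 F g []) h s := by
  by_cases hsM : s ∈ M
  · rw [next, hM h s hsM, PMF.expect_pure]
    exact (termVal_purePlay_eq_expect hs).le
  · conv_lhs => rw [← (π h s).expect_const (termVal P (purePlay d) 1 F g [] s)]
    refine PMF.expect_mono _ fun a ha => ?_
    simpa using hd.local_min s hsM hs a (hπ h s a ha)

/-- If Max plays `d`, and `u` is subharmonic outside of `F` and nonpositive where `F` is avoided
almost surely, for every memoryless deterministic counterplay of Min, then `u` is a lower bound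
for the value of the game that stops in `F` with payoff `u`, for all plays of Min. -/
theorem le_termVal_of_forall_purePlay (hA : ∀ s, d s ∈ A s) {u : S → ℝ}
    (hu : ∀ d' : S → L, (∀ s, d' s ∈ A s) → (∀ s ∈ M, d' s = d s) →
      (∀ h, ∀ s ∉ F, u s ≤ next P (purePlay d') (fun _ => u) h s) ∧
        ∀ s, termVal P (purePlay d') 1 F (fun _ => 1) [] s = 0 → u s ≤ 0)
    (hπ : ∀ h s, ∀ a ∈ (π h s).support, a ∈ A s) (hM : ∀ h, ∀ s ∈ M, π h s = PMF.pure (d s))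
    (h : List (PathStep S L)) (s : S) : u s ≤ termVal P π 1 F u h s := by
  -- With Max's actions restricted to `d`, the saddle `d'` is a best memoryless reply of Min, so it
  -- suffices to bound the payoff of `d'`.
  obtain ⟨d', hd'⟩ := exists_isSaddle P M (A := fun s => {a ∈ A s | s ∈ M → a = d s})
    (fun s => ⟨d s, hA s, fun _ => rfl⟩) F u
  obtain ⟨hu1, hu2⟩ := hu d' (fun s => (hd'.mem s).1) fun s => (hd'.mem s).2
  refine le_trans ?_ (hd'.le_of_max π (fun h s a ha => ⟨hπ h s a ha, fun hs => ?_⟩)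
    (fun h s hs => by rw [hM h s hs, (hd'.mem s).2 hs]) h s)
  swap
  · rwa [hM h s hs, PMF.support_pure, Set.mem_singleton_iff] at ha
  let ρ : S → ℝ := termVal P (purePlay d') 1 F (fun _ => 1) []
  let e : S → ℝ := fun s => u s - termVal P (purePlay d') 1 F u [] s
  have hρ : ∀ h s, termVal P (purePlay d') 1 F (fun _ => 1) h s = ρ s :=
    fun h s => termVal_purePlay d' h []
  have hρ0 : ∀ s, 0 ≤ ρ s := fun s => termVal_one_nonneg
  -- Finiteness of `S` turns pointwise domination by the reaching probability into a uniform one.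
  -- Where `ρ` vanishes the payoff is `0` and `u ≤ 0`; such terms of the sum are `0` since division
  -- by zero gives `0`.
  have he : ∀ s, e s ≤ (∑ t, |e t| / ρ t) * ρ s := by
    intro s
    rcases (hρ0 s).eq_or_lt with h0 | hpos
    · rw [← h0, mul_zero, sub_nonpos]
      obtain ⟨C, -, hC⟩ := exists_abs_le u
      have h1 := abs_termVal_le (P := P) (π := purePlay d') (r := 1) (h := []) (s := s) (by simp)
        fun s (_ : s ∈ F) => hC s
      rw [hρ, ← h0, mul_zero] at h1
      rw [abs_nonpos_iff.1 h1]
      exact hu2 s h0.symm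
    · calc e s ≤ |e s| / ρ s * ρ s := by rw [div_mul_cancel₀ _ hpos.ne']; exact le_abs_self _
        _ ≤ _ := mul_le_mul_of_nonneg_right (Finset.single_le_sum (f := fun t => |e t| / ρ t)
            (fun t _ => div_nonneg (abs_nonneg _) (hρ0 t)) (Finset.mem_univ s)) hpos.le
  rw [← sub_nonpos]
  refine nonpos_of_le_next (P := P) (π := purePlay d') (F := F) (Y := fun _ => e)
    (fun h s => (he s).trans_eq (by rw [hρ])) (fun h s => ?_) [] s
  by_cases hs : s ∈ F
  · left
    simp only [e]
    rw [termVal_mem hs, sub_self]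
  · refine Or.inr ⟨hs, ?_⟩
    simp only [e]
    rw [next_sub (Y := fun _ => u) (Y' := fun _ => termVal P (purePlay d') 1 F u []),
      termVal_purePlay_eq_expect hs]
    conv_rhs => arg 2; rw [next, purePlay, PMF.expect_pure]
    exact sub_le_sub_right (hu1 h s hs) _

end TerminalGame

section Lex

variable {n : ℕ} {v c : Fin (n + 1) → ℝ}

/-- Since `v` exceeds `c` at `k`, the order must be decided strictly before `k`, hence before the
last index. -/
theorem toLex_le_update_last (h : toLex v ≤ toLex c) {k : Fin (n + 1)} (hk : c k < v k) (z : ℝ) :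
    toLex v ≤ toLex (Function.update c (Fin.last n) z) := by
  rcases h.lt_or_eq with ⟨i, h0, hi⟩ | h
  · have hik : i < k := by
      by_contra hki
      rcases (not_lt.1 hki).lt_or_eq with h1 | h1
      · exact hk.ne' (h0 k h1)
      · subst h1
        exact lt_asymm hk hi
    have hlast : ∀ j ≤ i, j ≠ Fin.last n := fun j hj =>
      (hj.trans_lt (hik.trans_le (Fin.le_last k))).ne
    refine le_of_lt ⟨i, fun j hj => ?_, ?_⟩
    · simpa [Function.update_of_ne (hlast j (le_of_lt hj))] using h0 j hj
    · simpa [Function.update_of_ne (hlast i le_rfl)] using hi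
  · rw [toLex_inj.1 h] at hk
    exact absurd hk (lt_irrefl _)

end Lex

/-- The payoff of a path that avoids the target of an objective. -/
def RSObjective.offset {S : Type*} : RSObjective S → ℝ
  | reach _ => 0
  | safe _ => 1

/-- What the payoff gains by ending in a sink, compared with avoiding all targets. -/
noncomputable def RSObjective.gain {S : Type*} : RSObjective S → S → ℝ
  | reach T => T.indicator 1
  | safe T => fun s => - T.indicator 1 s

/-! ### Objectives as terminal payoffs -/

namespace StochasticGame

open TerminalGame

variable {S L : Type*} {G : StochasticGame S L}

theorem support_play (σ : G.MaxStrategy) (τ : G.MinStrategy) (h : List (PathStep S L)) (s : S) :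
    ∀ a ∈ (play σ τ h s).support, a ∈ G.act s := by
  unfold play
  split_ifs with hs
  · exact σ.choice_mem h ⟨s, hs⟩
  · exact τ.choice_mem h ⟨s, hs⟩

/-- The memoryless deterministic strategy that plays `d`. -/
noncomputable def pureStrategy (A : Set S) (d : S → L) (hd : ∀ s, d s ∈ G.act s) :
    G.Strategy A where
  choice _ s := PMF.pure (d s)
  choice_mem h s := support_purePlay hd h (s : S)

theorem play_pureStrategy_left {d : S → L} (hd : ∀ s, d s ∈ G.act s) (τ : G.MinStrategy)
    (h : List (PathStep S L)) {s : S} (hs : s ∈ G.maxStates) :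
    play (pureStrategy G.maxStates d hd) τ h s = PMF.pure (d s) := dif_pos hs

theorem play_pureStrategy_right {d : S → L} (hd : ∀ s, d s ∈ G.act s) (σ : G.MaxStrategy)
    (h : List (PathStep S L)) {s : S} (hs : s ∉ G.maxStates) :
    play σ (pureStrategy G.minStates d hd) h s = PMF.pure (d s) := dif_neg hs

theorem play_pureStrategy {d d' : S → L} (hd : ∀ s, d s ∈ G.act s) (hd' : ∀ s, d' s ∈ G.act s)
    (h : ∀ s ∈ G.maxStates, d' s = d s) :
    play (pureStrategy G.maxStates d hd) (pureStrategy G.minStates d' hd') = purePlay d' := by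
  ext1 l
  ext1 s
  by_cases hs : s ∈ G.maxStates
  · rw [play_pureStrategy_left hd _ l hs, purePlay, h s hs]
  · rw [play_pureStrategy_right hd' _ l hs, purePlay]

variable [Fintype S] [Fintype L]

theorem lexValue_eq_of_saddle {n : ℕ} {Ω : Fin n → Objective S} {s : S} {w : LexCube n}
    (σ : G.MaxStrategy) (hσ : ∀ τ, w ≤ toLex fun i => objProb σ τ s (Ω i))
    (τ : G.MinStrategy) (hτ : ∀ σ, (toLex fun i => objProb σ τ s (Ω i)) ≤ w) :
    G.lexValue Ω s = w := by
  apply le_antisymm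
  · refine (isLUB_lexSup _).2 ?_
    rintro _ ⟨σ', rfl⟩
    exact ((isGLB_lexInf _).1 (Set.mem_range_self τ)).trans (hτ σ')
  · refine le_trans ?_ ((isLUB_lexSup _).1 (Set.mem_range_self σ))
    refine (isGLB_lexInf _).2 ?_
    rintro _ ⟨τ', rfl⟩
    exact hσ τ'

theorem next_sink {π : Play S L} (hπ : ∀ h s, ∀ a ∈ (π h s).support, a ∈ G.act s) {s : S}
    (hs : s ∈ G.sinks) {Y : List (PathStep S L) → S → ℝ} {c : ℝ} (hY : ∀ h, Y h s = c)
    (h : List (PathStep S L)) : next G.trans π Y h s = c := by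
  rw [← (π h s).expect_const c]
  refine PMF.expect_congr _ fun a ha => ?_
  rw [← (G.trans s a).expect_const c]
  refine PMF.expect_congr _ fun t ht => ?_
  rw [(PMF.apply_eq_one_iff _ _).1 (hs a (hπ h s a ha)), Set.mem_singleton_iff] at ht
  rw [ht, hY]

/-- A path that enters `D` outside `T` is stuck in a sink and never reaches `T`, so all targets can
share the single stopping set `D`. -/
theorem hitPay_eq_of_sinks {π : Play S L} (hπ : ∀ h s, ∀ a ∈ (π h s).support, a ∈ G.act s)
    {T D : Set S} (hTD : T ⊆ D) (hD : D ⊆ G.sinks) (k : ℕ) (h : List (PathStep S L)) (s : S) :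
    hitPay G.trans π T (T.indicator 1) k h s = hitPay G.trans π D (T.indicator 1) k h s := by
  have hsink : ∀ k h, ∀ s ∈ G.sinks, s ∉ T → hitPay G.trans π T (T.indicator 1) k h s = 0 := by
    intro k
    induction k with
    | zero => exact fun h s _ hsT => hitPay_notMem_zero hsT
    | succ k ih =>
      intro h s hs hsT
      rw [hitPay_notMem_succ hsT, next_sink hπ hs fun h => ih h s hs hsT]
  induction k generalizing h s with
  | zero =>
    by_cases hsT : s ∈ T
    · rw [hitPay_mem_zero hsT, hitPay_mem_zero (hTD hsT)]
    · simp [hitPay, hsT]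
  | succ k ih =>
    by_cases hsT : s ∈ T
    · rw [hitPay_mem_succ hsT, hitPay_mem_succ (hTD hsT)]
    · by_cases hsD : s ∈ D
      · rw [hsink _ h s (hD hsD) hsT, hitPay_mem_succ hsD]
      · rw [hitPay_notMem_succ hsD, hitPay_notMem_succ hsT]
        congr 1
        ext h t
        exact ih h t

theorem measureReal_reachProp (σ : G.MaxStrategy) (τ : G.MinStrategy) {T D : Set S} (hTD : T ⊆ D)
    (hD : D ⊆ G.sinks) (s : S) : (pathMeasure σ τ s).real (reachProp T) =
      termVal G.trans (play σ τ) 1 D (T.indicator 1) [] s := by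
  rw [reachProp_eq_untilProp, measureReal_untilProp σ τ subset_rfl]
  simp only [termVal, hitPay_eq_of_sinks (support_play σ τ) hTD hD]

theorem objProb_std (σ : G.MaxStrategy) (τ : G.MinStrategy) {O : RSObjective S} {D : Set S}
    (hO : O.target ⊆ D) (hD : D ⊆ G.sinks) (s : S) :
    (objProb σ τ s (.std O) : ℝ) =
      O.offset + termVal G.trans (play σ τ) 1 D O.gain [] s := by
  cases O with
  | reach T =>
    rw [RSObjective.offset, zero_add]
    exact measureReal_reachProp σ τ hO hD s
  | safe T =>
    have hmeas : MeasurableSet (reachProp T : Set (InfPath S L)) := by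
      rw [reachProp_eq_untilProp]
      exact measurableSet_untilProp _ _
    simp only [RSObjective.offset, RSObjective.gain, termVal_neg]
    rw [← measureReal_reachProp σ τ (T := T) hO hD s, ← sub_eq_add_neg]
    exact probReal_compl_eq_one_sub hmeas

/-- The payoff on `F` is a combination of indicators of single states, and `termVal` is linear in
the payoff. -/
theorem objProb_quantReach (σ : G.MaxStrategy) (τ : G.MinStrategy) {F : Set S}
    (q : F → unitInterval) {f : S → ℝ} (hf : ∀ t : F, f t = q t) (s : S) :
    (objProb σ τ s (.quantReach F q) : ℝ) = termVal G.trans (play σ τ) 1 F f [] s := by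
  classical
  have h1 : (objProb σ τ s (.quantReach F q) : ℝ) = ∑ t : F, (q t : ℝ) *
      termVal G.trans (play σ τ) 1 F (({(t : S)} : Set S).indicator 1) [] s := by
    simp only [objProb, quantReachProb, propProb]
    refine Finset.sum_congr (by ext; simp) fun t _ => ?_
    rw [mul_comm, measureReal_untilProp σ τ (Set.singleton_subset_iff.2 t.2)]
  rw [h1, ← termVal_sum _ (by simp)]
  refine termVal_congr fun t ht => ?_
  rw [Finset.sum_eq_single ⟨t, ht⟩]
  · simp [← hf ⟨t, ht⟩]
  · intro b _ hb
    have : t ≠ b := fun h => hb (Subtype.ext h.symm)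
    simp [this]
  · simp

end StochasticGame

/-! ### Lex-optimal plays and stopping in the final set -/

namespace StochasticGame

open TerminalGame Filter Topology

variable {S L : Type*} [Fintype S] [Fintype L] {G : StochasticGame S L}

/-- A memoryless deterministic play that is optimal for the weighted sum of the objectives `Ω`
with weights `ε ^ i`, for arbitrarily small `ε`. Here `D` is a set of sinks that contains
all targets. -/
def IsLexSaddle {n : ℕ} (Ω : Fin n → RSObjective S) (D : Set S) (d : S → L) : Prop :=
  ∃ᶠ ε : ℝ in 𝓝[>] 0, IsSaddle G.trans G.maxStates G.act 1 D
    (fun s => ∑ i : Fin n, ε ^ (i : ℕ) * (Ω i).gain s) d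

theorem exists_isLexSaddle {n : ℕ} (Ω : Fin n → RSObjective S) (D : Set S) :
    ∃ d, IsLexSaddle (G := G) Ω D d :=
  frequently_of_forall_exists (Eventually.of_forall fun _ => exists_isSaddle _ _ G.act_nonempty _ _)

namespace IsLexSaddle

variable {n : ℕ} {Ω : Fin n → RSObjective S} {D F : Set S} {d : S → L}

theorem mem (hd : IsLexSaddle (G := G) Ω D d) : ∀ s, d s ∈ G.act s := hd.exists.choose_spec.mem

/-- The components of the value of a lex-saddle. -/
noncomputable def value (G : StochasticGame S L) (Ω : Fin n → RSObjective S) (D : Set S)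
    (d : S → L) (s : S) (i : Fin n) : ℝ :=
  (Ω i).offset + termVal G.trans (purePlay d) 1 D (Ω i).gain [] s

/-- The payoffs when the play `π` stops in `F` with the value of a lex-saddle as payoff. -/
noncomputable def stopped (G : StochasticGame S L) (Ω : Fin n → RSObjective S) (D F : Set S)
    (d : S → L) (π : Play S L) (s : S) (i : Fin n) : ℝ :=
  (Ω i).offset +
    termVal G.trans π 1 F (fun t => value G Ω D d t i - (Ω i).offset) [] s

theorem sum_offset_add (π : Play S L) (F : Set S) (ε : ℝ) (s : S) (c : Fin n → ℝ)
    (f : Fin n → S → ℝ) :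
    ∑ i : Fin n, ε ^ (i : ℕ) * (c i + termVal G.trans π 1 F (f i) [] s) =
      ∑ i : Fin n, ε ^ (i : ℕ) * c i +
        termVal G.trans π 1 F (fun t => ∑ i : Fin n, ε ^ (i : ℕ) * f i t) [] s := by
  rw [termVal_sum _ (by simp)]
  simp only [mul_add, Finset.sum_add_distrib]

/-- This identifies the weighted excess over the offsets with the value function of the weighted
game, so the saddle inequalities apply to it. -/
theorem sum_value_sub (ε : ℝ) :
    (fun t => ∑ i : Fin n, ε ^ (i : ℕ) * (value G Ω D d t i - (Ω i).offset)) =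
      termVal G.trans (purePlay d) 1 D (fun t => ∑ i : Fin n, ε ^ (i : ℕ) * (Ω i).gain t) [] := by
  ext t
  rw [termVal_sum _ (by simp)]
  simp only [value, add_sub_cancel_left]

theorem sum_value (ε : ℝ) (s : S) : ∑ i : Fin n, ε ^ (i : ℕ) * value G Ω D d s i =
    ∑ i : Fin n, ε ^ (i : ℕ) * (Ω i).offset +
      termVal G.trans (purePlay d) 1 D (fun t => ∑ i : Fin n, ε ^ (i : ℕ) * (Ω i).gain t) [] s :=
  sum_offset_add _ _ _ _ _ _

theorem sum_stopped (π : Play S L) (ε : ℝ) (s : S) :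
    ∑ i : Fin n, ε ^ (i : ℕ) * stopped G Ω D F d π s i =
      ∑ i : Fin n, ε ^ (i : ℕ) * (Ω i).offset + termVal G.trans π 1 F
        (termVal G.trans (purePlay d) 1 D (fun t => ∑ i : Fin n, ε ^ (i : ℕ) * (Ω i).gain t) [])
        [] s := by
  rw [← sum_value_sub]
  exact sum_offset_add _ _ _ _ _ _

theorem le_stopped_le {π : Play S L} (hd : IsLexSaddle (G := G) Ω D d) (hDF : D ⊆ F)
    (hπ : ∀ h s, ∀ a ∈ (π h s).support, a ∈ G.act s)
    (hM : ∀ h, ∀ s ∉ G.maxStates, π h s = PMF.pure (d s)) (s : S) :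
    toLex (fun i => (Ω i).offset + termVal G.trans π 1 D (Ω i).gain [] s) ≤
      toLex (stopped G Ω D F d π s) ∧
    toLex (stopped G Ω D F d π s) ≤ toLex (value G Ω D d s) := by
  have key := hd.mono fun ε hε => termVal_le_termVal_le (P := G.trans) (π := π) hDF
    (fun h s hs => hε.next_le hπ hM h fun h => hs (hDF h)) (hε.ge_of_min π hπ hM) [] s
  constructor
  · refine toLex_le_of_frequently (key.mono fun ε hε => ?_)
    rw [sum_offset_add, sum_stopped]
    exact add_le_add_right hε.1 _
  · refine toLex_le_of_frequently (key.mono fun ε hε => ?_)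
    rw [sum_value, sum_stopped]
    exact add_le_add_right hε.2 _

theorem le_stopped {π : Play S L} (hd : IsLexSaddle (G := G) Ω D d) (hDF : D ⊆ F)
    (hπ : ∀ h s, ∀ a ∈ (π h s).support, a ∈ G.act s)
    (hM : ∀ h, ∀ s ∈ G.maxStates, π h s = PMF.pure (d s)) (s : S) :
    toLex (value G Ω D d s) ≤ toLex (stopped G Ω D F d π s) ∧
    toLex (stopped G Ω D F d π s) ≤
      toLex (fun i => (Ω i).offset + termVal G.trans π 1 D (Ω i).gain [] s) := by
  have key := hd.mono fun ε hε => le_termVal_le_termVal (P := G.trans) (π := π) hDF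
    (fun h s hs => hε.le_next hπ hM h fun h => hs (hDF h)) (hε.le_of_max π hπ hM) [] s
  constructor
  · refine toLex_le_of_frequently (key.mono fun ε hε => ?_)
    rw [sum_value, sum_stopped]
    exact add_le_add_right hε.1 _
  · refine toLex_le_of_frequently (key.mono fun ε hε => ?_)
    rw [sum_offset_add, sum_stopped]
    exact add_le_add_right hε.2 _

theorem lexValue_std (hd : IsLexSaddle (G := G) Ω D d) (hΩ : ∀ i, (Ω i).target ⊆ D)
    (hD : D ⊆ G.sinks) (s : S) (i : Fin n) :
    (G.lexValue (fun i => .std (Ω i)) s i : ℝ) = value G Ω D d s i := by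
  have hv : ∀ i, (objProb (pureStrategy G.maxStates d hd.mem) (pureStrategy G.minStates d hd.mem)
      s (.std (Ω i)) : ℝ) = value G Ω D d s i := fun i => by
    rw [objProb_std _ _ (hΩ i) hD, play_pureStrategy hd.mem hd.mem fun _ _ => rfl, value]
  have heq := lexValue_eq_of_saddle (G := G) (s := s) (Ω := fun i => .std (Ω i))
    (w := toLex fun i => objProb (pureStrategy G.maxStates d hd.mem)
      (pureStrategy G.minStates d hd.mem) s (.std (Ω i)))
    (pureStrategy G.maxStates d hd.mem) (fun τ => ?_)
    (pureStrategy G.minStates d hd.mem) (fun σ => ?_)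
  · rw [heq]
    exact hv i
  · rw [← toLex_coe_le_iff]
    simp only [hv]
    simp only [objProb_std _ _ (hΩ _) hD]
    have := hd.le_stopped subset_rfl (support_play (pureStrategy G.maxStates d hd.mem) τ)
      (fun h s hs => play_pureStrategy_left hd.mem τ h hs) s
    exact this.1.trans this.2
  · rw [← toLex_coe_le_iff]
    simp only [hv]
    simp only [objProb_std _ _ (hΩ _) hD]
    have := hd.le_stopped_le subset_rfl (support_play σ (pureStrategy G.minStates d hd.mem))
      (fun h s hs => play_pureStrategy_right hd.mem σ h hs) s
    exact this.1.trans this.2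

end IsLexSaddle

open IsLexSaddle

variable {n : ℕ} {Ω : Fin (n + 1) → RSObjective S} {D F : Set S} {d : S → L}

/-- If some component of the value exceeds the offset outside of `F`, then Max's lex-optimal
strategy also guarantees the value if never reaching `F` pays `0` in the last component. -/
theorem IsLexSaddle.le_update_stopped {π : Play S L} (hd : IsLexSaddle (G := G) Ω D d)
    (hDF : D ⊆ F) (hF : ∀ t ∉ F, ∃ k, (Ω k).offset < value G Ω D d t k)
    (hπ : ∀ h s, ∀ a ∈ (π h s).support, a ∈ G.act s)
    (hM : ∀ h, ∀ s ∈ G.maxStates, π h s = PMF.pure (d s)) (s : S) :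
    toLex (value G Ω D d s) ≤ toLex (Function.update (stopped G Ω D F d π s) (Fin.last n)
      (termVal G.trans π 1 F (fun t => value G Ω D d t (Fin.last n)) [] s)) := by
  -- The payoff of avoiding `F` after the replacement: quantified reachability then pays `0`.
  let c : Fin (n + 1) → ℝ := Function.update (fun i => (Ω i).offset) (Fin.last n) 0
  have hc : Function.update (stopped G Ω D F d π s) (Fin.last n)
      (termVal G.trans π 1 F (fun t => value G Ω D d t (Fin.last n)) [] s) = fun i =>
      c i + termVal G.trans π 1 F (fun t => value G Ω D d t i - c i) [] s := by
    ext i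
    by_cases hi : i = Fin.last n
    · subst hi
      simp [c]
    · simp [c, hi, stopped]
  -- Finiteness of `S` makes the threshold on `ε` uniform in `t`.
  have hsmall : ∀ᶠ ε : ℝ in 𝓝[>] 0, ∀ t, toLex (value G Ω D d t) ≤ toLex c →
      ∑ i : Fin (n + 1), ε ^ (i : ℕ) * (value G Ω D d t i - c i) ≤ 0 := by
    rw [eventually_all]
    intro t
    by_cases ht : toLex (value G Ω D d t) ≤ toLex c
    · refine (eventually_le_of_toLex_le ht).mono fun ε hε _ => ?_
      simp only [mul_sub, Finset.sum_sub_distrib]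
      linarith
    · exact Eventually.of_forall fun ε h => absurd h ht
  rw [hc]
  refine toLex_le_of_frequently ((hd.and_eventually hsmall).mono fun ε hε => ?_)
  obtain ⟨hε, hsmall⟩ := hε
  rw [sum_offset_add]
  have key := le_termVal_of_forall_purePlay (P := G.trans) (F := F) (M := G.maxStates)
    (u := fun t => ∑ i : Fin (n + 1), ε ^ (i : ℕ) * (value G Ω D d t i - c i)) hd.mem
    (fun d' hd' hdd' => ?_) hπ hM [] s
  · have hsplit : ∑ i : Fin (n + 1), ε ^ (i : ℕ) * value G Ω D d s i =
        ∑ i : Fin (n + 1), ε ^ (i : ℕ) * c i +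
          ∑ i : Fin (n + 1), ε ^ (i : ℕ) * (value G Ω D d s i - c i) := by
      rw [← Finset.sum_add_distrib]
      exact Finset.sum_congr rfl fun i _ => by ring
    rw [hsplit]
    exact add_le_add_right key _
  have hM' : ∀ (h : List (PathStep S L)), ∀ s ∈ G.maxStates, purePlay d' h s = PMF.pure (d s) :=
    fun h s hs => by rw [purePlay, hdd' s hs]
  constructor
  · intro h t ht
    -- Replacing the offsets by `c` shifts the weighted value by a constant, which preserves
    -- subharmonicity.
    have hshift : (fun t => ∑ i : Fin (n + 1), ε ^ (i : ℕ) * (value G Ω D d t i - c i)) = fun t =>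
        termVal G.trans (purePlay d) 1 D
          (fun t => ∑ i : Fin (n + 1), ε ^ (i : ℕ) * (Ω i).gain t) [] t +
        ∑ i : Fin (n + 1), ε ^ (i : ℕ) * ((Ω i).offset - c i) := by
      rw [← sum_value_sub]
      ext t
      rw [← Finset.sum_add_distrib]
      exact Finset.sum_congr rfl fun i _ => by ring
    refine (congrFun hshift t).trans_le ?_
    rw [hshift, next_add (Y := fun _ => _) (Y' := fun _ _ => _), next_const]
    exact add_le_add_left (hε.le_next (support_purePlay hd') hM' h fun h => ht (hDF h)) _
  · intro t ht
    refine hsmall t ?_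
    have htF : t ∉ F := fun h => by
      rw [termVal_mem h] at ht
      exact one_ne_zero ht
    obtain ⟨k, hk⟩ := hF t htF
    -- If `d'` avoids `F` almost surely it also avoids `D`, so it yields exactly the offsets.
    -- Optimality of `d` bounds the value by them, and component `k` shows that the bound does not
    -- depend on the last one.
    refine toLex_le_update_last ?_ hk 0
    have hle := hd.le_stopped subset_rfl (support_purePlay hd') hM' t
    refine (hle.1.trans hle.2).trans_eq (congrArg toLex ?_)
    ext i
    obtain ⟨C, hC0, hC⟩ := exists_abs_le (Ω i).gain
    have h0 := abs_termVal_le (P := G.trans) (π := purePlay d') (r := 1) (h := []) (s := t)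
      (by simp) fun s (_ : s ∈ D) => hC s
    have h1 := mul_le_mul_of_nonneg_left
      ((termVal_one_mono (P := G.trans) (π := purePlay d') (h := []) (s := t) hDF).trans_eq ht) hC0
    rw [mul_zero] at h1
    rw [abs_nonpos_iff.1 (h0.trans h1), add_zero]

theorem objProb_update (hΩ : ∀ i, (Ω i).target ⊆ D) (hD : D ⊆ G.sinks) (q : F → unitInterval)
    {f : S → ℝ} (hf : ∀ t : F, f t = q t) (σ : G.MaxStrategy) (τ : G.MinStrategy) (s : S) :
    (fun i => (objProb σ τ s (Function.update (fun i => Objective.std (Ω i)) (Fin.last n)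
      (.quantReach F q) i) : ℝ)) =
    Function.update
      (fun i => (Ω i).offset + termVal G.trans (play σ τ) 1 D (Ω i).gain [] s) (Fin.last n)
      (termVal G.trans (play σ τ) 1 F f [] s) := by
  ext i
  by_cases hi : i = Fin.last n
  · subst hi
    rw [Function.update_self, Function.update_self, objProb_quantReach σ τ q hf]
  · rw [Function.update_of_ne hi, Function.update_of_ne hi, objProb_std σ τ (hΩ i) hD]

theorem lexValue_update_last (hd : IsLexSaddle (G := G) Ω D d) (hΩ : ∀ i, (Ω i).target ⊆ D)
    (hD : D ⊆ G.sinks) (hDF : D ⊆ F) (hF : ∀ t ∉ F, ∃ k, (Ω k).offset < value G Ω D d t k)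
    (hlast : 0 ≤ (Ω (Fin.last n)).offset) (q : F → unitInterval)
    (hq : ∀ t : F, value G Ω D d t (Fin.last n) = q t) (s : S) :
    G.lexValue (Function.update (fun i => Objective.std (Ω i)) (Fin.last n) (.quantReach F q)) s =
      G.lexValue (fun i => .std (Ω i)) s := by
  have hval : (fun i => (ofLex (G.lexValue (fun i => .std (Ω i)) s) i : ℝ)) = value G Ω D d s :=
    funext (lexValue_std hd hΩ hD s)
  generalize G.lexValue (fun i => .std (Ω i)) s = w at hval
  refine lexValue_eq_of_saddle (pureStrategy G.maxStates d hd.mem) (fun τ => ?_)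
    (pureStrategy G.minStates d hd.mem) (fun σ => ?_)
  · refine (toLex_coe_le_iff (x := ofLex w)).1 ?_
    have hπ := support_play (pureStrategy G.maxStates d hd.mem) τ
    have hM : ∀ h, ∀ s ∈ G.maxStates, _ := fun h s hs => play_pureStrategy_left hd.mem τ h hs
    have h1 := hd.le_stopped hDF hπ hM s
    rw [objProb_update hΩ hD q (f := fun t => value G Ω D d t (Fin.last n)) hq, hval]
    exact le_toLex_update_last h1.1 h1.2 (hd.le_update_stopped hDF hF hπ hM s)
  · refine (toLex_coe_le_iff (y := ofLex w)).1 ?_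
    have hπ := support_play σ (pureStrategy G.minStates d hd.mem)
    have hM : ∀ h, ∀ s ∉ G.maxStates, _ := fun h s hs => play_pureStrategy_right hd.mem σ h hs
    have h1 := hd.le_stopped_le hDF hπ hM s
    rw [objProb_update hΩ hD q (f := fun t => value G Ω D d t (Fin.last n)) hq, hval]
    refine toLex_update_last_le h1.1 h1.2 ?_
    set π := play σ (pureStrategy G.minStates d hd.mem)
    -- The new last component is that of `stopped` with the offset multiplied by the probability of
    -- reaching `F`, so it is no larger.
    have h2 := termVal_add (P := G.trans) (π := π) (r := 1) (F := F)
      (g := fun t => value G Ω D d t (Fin.last n) - (Ω (Fin.last n)).offset)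
      (g' := fun _ => (Ω (Fin.last n)).offset) (h := []) (s := s) (by simp)
    have h3 := termVal_const_mul (P := G.trans) (π := π) (r := 1) (F := F) (g := fun _ => 1)
      (h := []) (s := s) (Ω (Fin.last n)).offset
    simp only [mul_one] at h3
    simp only [sub_add_cancel, h3] at h2
    rw [h2, stopped, add_comm]
    exact add_le_add_left (mul_le_of_le_one_right hlast termVal_one_le) _

end StochasticGame

theorem mainTheorem8 {S L : Type*} [Fintype S] [Finite L] (G : StochasticGame S L)
    {n : ℕ} (Ω : Fin (n + 1) → RSObjective S) (hΩ : G.IsAbsorbing Ω)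
    (T : Set S) (hlast : Ω (Fin.last n) = RSObjective.safe T)
    (q : G.finalSet Ω → unitInterval)
    (hq : ∀ t : G.finalSet Ω,
      q t = G.lexValue (fun i => Objective.std (Ω i)) (t : S) (Fin.last n))
    (s : S) :
    G.lexValue (fun i => Objective.std (Ω i)) s =
      G.lexValue
        (Function.update (fun i => Objective.std (Ω i)) (Fin.last n)
          (Objective.quantReach (G.finalSet Ω) q)) s := by
  have := Fintype.ofFinite L
  let D : Set S := ⋃ i, (Ω i).target
  have hΩD : ∀ i, (Ω i).target ⊆ D := fun i => Set.subset_iUnion (fun i => (Ω i).target) i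
  have hD : D ⊆ G.sinks := Set.iUnion_subset hΩ
  obtain ⟨d, hd⟩ := StochasticGame.exists_isLexSaddle (G := G) Ω D
  have hv := StochasticGame.IsLexSaddle.lexValue_std hd hΩD hD
  have hoffset : ∀ k, (Ω k).IsReach → (Ω k).offset = 0 := by
    intro k hk
    cases h : Ω k with
    | reach T => rfl
    | safe T => rw [h] at hk; exact hk.elim
  refine (StochasticGame.lexValue_update_last hd hΩD hD (fun t ht => ?_) (fun t ht => ?_) ?_ q
    (fun t => by rw [hq, hv]) s).symm
  · by_cases hR : ∃ k, (Ω k).IsReach ∧ t ∈ (Ω k).target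
    · obtain ⟨k, hk, htk⟩ := hR
      exact Or.inl (Set.mem_biUnion hk htk)
    -- A sink of `D` outside all reachability targets stops at once with gain `0` in every
    -- reachability component, so it lies in every `zeroSet` for those indices.
    · refine Or.inr (Set.mem_iInter₂.2 fun k hk => Subtype.ext ?_)
      rw [hv, StochasticGame.IsLexSaddle.value, hoffset k hk, TerminalGame.termVal_mem ht, zero_add]
      cases h : Ω k with
      | reach T =>
        refine Set.indicator_of_notMem (fun htT => hR ⟨k, hk, ?_⟩) _
        rwa [h]
      | safe T => change (Ω k).IsReach at hk; rw [h] at hk; exact hk.elim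
  · have hz : ∃ k, (Ω k).IsReach ∧ t ∉ G.zeroSet Ω k := by
      by_contra! hcon
      exact ht (Or.inr (Set.mem_iInter₂.2 hcon))
    obtain ⟨k, hk, htk⟩ := hz
    refine ⟨k, ?_⟩
    rw [hoffset k hk, ← hv]
    exact unitInterval.pos_iff_ne_zero.2 htk
  · rw [hlast]
    exact zero_le_one
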